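/- Let $0<\alpha<2$, $0<\beta<1$ and $H=\alpha/2$. Let $\|\cdot\|$ be a norm on the space $C_0^\gamma[0,1]$ of $\gamma$-H\"older continuous functions on $[0,1]$ vanishing at $0$, for some $0<\gamma<H$, measurable with respect to the $\sigma$-algebra generated by the evaluations. Let $B_H$ be fractional Brownian motion on $[0,1]$ with Hurst parameter $H$, i.e. the centred Gaussian process with covariance $\tfrac12(s^{2H}+t^{2H}-|s-t|^{2H})$, and let $B_{\alpha,\beta}$ be generalized grey Brownian motion on $[0,1]$, i.e. a process with the same finite-dimensional distributions as $(\sqrt{L_\beta}\,B_H(t))_{0\le t\le 1}$, where $L_\beta>0$ is independent of $B_H$ and has as density on $(0,\infty)$ the $M$-Wright function $$M_\beta(x)=\sum_{n=0}^\infty\frac{(-x)^n}{n!\,\Gamma(1-\beta-\beta n)}$$ ($1/\Gamma:=0$ at the poles of $\Gamma$); both processes have paths in $C_0^\gamma[0,1]$. Put $\eta_k(H)=\mathbb E\big[\|B_H\|^{-k}\big]$ for $k\in\mathbb N$. (i) Assume that there are $\theta,C_1,C_2>0$ such that $$-C_1\varepsilon^{-\theta}\le\log\mathbb P\big[\|B_H\|\le\varepsilon\big]\le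 -C_2\varepsilon^{-\theta},\qquad \varepsilon\in(0,1].$$ Then $\eta_2(H)<\infty$ and $$\mathbb P\big[\|B_{\alpha,\beta}\|\le\varepsilon\big]\sim\frac{\eta_2(H)\,\varepsilon^2}{\Gamma(1-\beta)},\qquad \varepsilon\downarrow0.$$ If, additionally, $2/\theta+\beta<1$, then all $\eta_{2n+2}(H)$, $n\ge0$, are finite, and for all $\varepsilon\ge0$ there is the convergent series representation $$\mathbb P\big[\|B_{\alpha,\beta}\|\le\varepsilon\big]=2\sum_{n=0}^\infty\frac{(-1)^n\,\eta_{2n+2}(H)}{(2n+2)\,n!\,\Gamma(1-\beta-\beta n)}\,\varepsilon^{2n+2}.\tag{$*$}$$ (ii) In particular, if $\|\cdot\|$ is the uniform norm $\|f\|_\infty=\sup_{0\le t\le1}|f(t)|$ and $\alpha+\beta<1$, then all $\eta_{2n+2}(H)$ are finite and $(*)$ holds for all $\varepsilon\ge0$ (without further assumptions). -/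

import Mathlib

open MeasureTheory ProbabilityTheory Set Filter Topology unitInterval
open scoped NNReal ENNReal

/-- The space of `γ`-Hölder continuous functions on `[0,1]` that vanish at `0`. It carries the
σ-algebra generated by the evaluations `f ↦ f t` (as a subtype of `[0,1] → ℝ`). -/
def holderSpace (γ : ℝ≥0) : Submodule ℝ (I → ℝ) where
  carrier := {f | f 0 = 0 ∧ MemHolder γ f}
  zero_mem' := ⟨rfl, memHolder_zero⟩
  add_mem' := fun {f g} hf hg => ⟨by simp [hf.1, hg.1], hf.2.add hg.2⟩
  smul_mem' := fun c f hf => ⟨by simp [hf.1], hf.2.smul⟩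

/-- The real process `(t, ω) ↦ X ω t` of a random element `X` of `holderSpace γ`. -/
def toProcess {Ω : Type*} {γ : ℝ≥0} (X : Ω → holderSpace γ) : I → Ω → ℝ :=
  fun t ω => (X ω : I → ℝ) t

/-- `B` is a (standard) fractional Brownian motion on `[0,1]` with Hurst parameter `H`:
a centred Gaussian process with covariance `(s^{2H} + t^{2H} - |s-t|^{2H}) / 2`. -/
structure IsFBM {Ω : Type*} [MeasurableSpace Ω] (H : ℝ) (B : I → Ω → ℝ) (P : Measure Ω) :
    Prop where
  measurable : ∀ t, Measurable (B t)
  gaussian : IsGaussianProcess B P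
  mean : ∀ t, ∫ ω, B t ω ∂P = 0
  cov : ∀ s t : I, cov[B s, B t; P] =
    ((s : ℝ) ^ (2 * H) + (t : ℝ) ^ (2 * H) - |(s : ℝ) - (t : ℝ)| ^ (2 * H)) / 2

/-- The `M`-Wright function `M_β(x) = ∑ (-x)^n / (n! Γ(1-β-βn))`. Since `Real.Gamma` is `0` at
the poles of `Γ` and `1 / 0 = 0`, the summand vanishes there, as `1 / Γ` does. -/
noncomputable def MWright (β x : ℝ) : ℝ :=
  ∑' n : ℕ, (-x) ^ n / ((n.factorial : ℝ) * Real.Gamma (1 - β - β * n))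

/-- `L` is a positive random variable whose density is `M_β` on `(0,∞)`. -/
structure HasMWrightDensity {Ω : Type*} [MeasurableSpace Ω] (β : ℝ) (L : Ω → ℝ) (P : Measure Ω) :
    Prop where
  measurable : Measurable L
  integrable : IntegrableOn (MWright β) (Ioi 0)
  prob : ∀ A : Set ℝ, MeasurableSet A → P.real (L ⁻¹' A) = ∫ x in A ∩ Ioi 0, MWright β x

/-- `X` is a generalized grey Brownian motion `B_{α,β}` on `[0,1]`: it has the same
finite-dimensional distributions as `t ↦ √L · B t`, where `B` is a fractional Brownian motion with
Hurst parameter `α / 2` and `L` is independent of `B` with density `M_β`. -/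
structure IsGGBM {Ω : Type*} [MeasurableSpace Ω] (α β : ℝ) (X : I → Ω → ℝ) (P : Measure Ω) :
    Prop where
  measurable : ∀ t, Measurable (X t)
  law : ∃ (Ω' : Type) (_ : MeasurableSpace Ω') (P' : Measure Ω') (L : Ω' → ℝ) (B : I → Ω' → ℝ),
    IsProbabilityMeasure P' ∧ IsFBM (α / 2) B P' ∧ HasMWrightDensity β L P' ∧
    IndepFun L (fun ω t => B t ω) P' ∧
    ∀ J : Finset I, IdentDistrib (fun ω => J.restrict fun t => X t ω)
      (fun ω => J.restrict fun t => √(L ω) * B t ω) P P'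

/-- The two-sided exponential small ball estimate with exponent `θ` for `‖B‖ = p (B ·)`. (The upper
bound excludes probability `0`, for which `Real.log` would be `0`.) -/
def SmallBallEstimate {Ω : Type*} [MeasurableSpace Ω] {γ : ℝ≥0} (p : Seminorm ℝ (holderSpace γ))
    (B : Ω → holderSpace γ) (P : Measure Ω) (θ : ℝ) : Prop :=
  0 < θ ∧ ∃ C₁ > (0 : ℝ), ∃ C₂ > (0 : ℝ), ∀ ε ∈ Ioc (0 : ℝ) 1,
    -C₁ * ε ^ (-θ) ≤ Real.log (P.real {ω | p (B ω) ≤ ε}) ∧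
    Real.log (P.real {ω | p (B ω) ≤ ε}) ≤ -C₂ * ε ^ (-θ)

/-- The negative moment `η_k = E[‖B‖^{-k}] ∈ [0,∞]`, where `‖B‖ = p (B ·)`. -/
noncomputable def negMoment {Ω : Type*} [MeasurableSpace Ω] {γ : ℝ≥0}
    (p : Seminorm ℝ (holderSpace γ)) (B : Ω → holderSpace γ) (P : Measure Ω) (k : ℕ) : ℝ≥0∞ :=
  ∫⁻ ω, (ENNReal.ofReal (p (B ω)))⁻¹ ^ k ∂P

/-- The series representation
`P[‖X‖ ≤ ε] = 2 ∑ (-1)^n η_{2n+2} / ((2n+2) n! Γ(1-β-βn)) ε^{2n+2}` for all `ε ≥ 0`,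
with finite coefficients and a convergent series. -/
def SmallBallSeries {Ω Ω' : Type*} [MeasurableSpace Ω] [MeasurableSpace Ω'] {γ : ℝ≥0} (β : ℝ)
    (p : Seminorm ℝ (holderSpace γ)) (X : Ω → holderSpace γ) (P : Measure Ω)
    (B : Ω' → holderSpace γ) (P' : Measure Ω') : Prop :=
  (∀ n : ℕ, negMoment p B P' (2 * n + 2) < ∞) ∧
  ∀ ε : ℝ, 0 ≤ ε → HasSum
    (fun n : ℕ => 2 * ((-1) ^ n * (negMoment p B P' (2 * n + 2)).toReal /
      ((2 * n + 2) * (n.factorial : ℝ) * Real.Gamma (1 - β - β * n)) * ε ^ (2 * n + 2)))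
    (P.real {ω | p (X ω) ≤ ε})

/-! Conditioning on the path of `B` gives `P[√L‖B‖ ≤ ε] = E[F((ε/‖B‖)²)]`, where `F` is the
distribution function of `L` (`IsGGBM.measureReal_le_eq_integral`). Integrating the Wright series,
`F` is a power series in `y` with leading term `y / Γ(1-β)`. Dominated convergence, using only `η₂ <
∞`, gives the asymptotics; termwise expectation gives the series.

The interchange is a competition of factorials. The upper small ball bound makes
`exp((c/2)‖B‖^(-θ))` integrable, so `η_{2n+2}` grows at most like `(n!)^(2/θ)`, while the Wright
coefficients decay at least like `(n!)^(β-1)`, both up to geometric factors. Hence the condition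
`2/θ + β < 1`. The lower small ball bound plays no role.

For the uniform norm the upper bound is proved with `θ = 1/H = 2/α`. Since `α < 1`, increments of
`B` on a grid of mesh `1/n` are nonpositively correlated, and the part of each increment independent
of its predecessors has variance at least `n^(-2H)/2`. Each further grid value thus stays in `[-ε,
ε]` with conditional probability at most `2εn^H/√π`; take the product and choose `n` of order
`ε^(-1/H)`. -/

/-! ### Law of the process and conditioning on the path -/

/-- Two centred real Gaussian processes with the same covariance have the same law. -/
theorem map_eq_of_isGaussianProcess {T Ω Ω' : Type*} [MeasurableSpace Ω] [MeasurableSpace Ω']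
    {P : Measure Ω} {Q : Measure Ω'} [IsProbabilityMeasure P] [IsProbabilityMeasure Q]
    {X : T → Ω → ℝ} {Y : T → Ω' → ℝ}
    (mX : ∀ t, Measurable (X t)) (mY : ∀ t, Measurable (Y t))
    (hX : IsGaussianProcess X P) (hY : IsGaussianProcess Y Q)
    (eX : ∀ t, ∫ ω, X t ω ∂P = 0) (eY : ∀ t, ∫ ω, Y t ω ∂Q = 0)
    (hcov : ∀ s t, cov[X s, X t; P] = cov[Y s, Y t; Q]) :
    P.map (fun ω t ↦ X t ω) = Q.map (fun ω t ↦ Y t ω) := by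
  have key : ∀ J : Finset T,
      P.map (fun ω ↦ J.restrict fun t ↦ X t ω) = Q.map (fun ω ↦ J.restrict fun t ↦ Y t ω) := by
    intro J
    have gX := hX.hasGaussianLaw J
    have gY := hY.hasGaussianLaw J
    have := gX.isGaussian_map
    have := gY.isGaussian_map
    -- A Gaussian law is determined by the mean and variance of each linear functional; in
    -- coordinates both reduce to means and covariances of the process.
    refine Measure.ext_of_charFunDual (funext fun L ↦ ?_)
    rw [gX.charFunDual_map_eq_fun, gY.charFunDual_map_eq_fun]
    classical
    obtain ⟨a, hL⟩ : ∃ a : J → ℝ, ∀ x : J → ℝ, L x = ∑ i, a i * x i := by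
      refine ⟨fun i ↦ L (Pi.single i 1), fun x ↦ ?_⟩
      conv_lhs => rw [pi_eq_sum_univ' x]
      rw [map_sum]
      refine Finset.sum_congr rfl fun i _ ↦ ?_
      rw [map_smul, smul_eq_mul, mul_comm]
    have m2X : ∀ t, MemLp (X t) 2 P := fun t ↦ (hX.hasGaussianLaw_eval t).memLp_two
    have m2Y : ∀ t, MemLp (Y t) 2 Q := fun t ↦ (hY.hasGaussianLaw_eval t).memLp_two
    have e1 : ∫ ω, L (J.restrict fun t ↦ X t ω) ∂P = 0 := by
      simp_rw [hL, Finset.restrict]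
      rw [integral_finsetSum _ fun i _ ↦ ((m2X i.1).integrable (by norm_num)).const_mul _]
      simp [integral_const_mul, eX]
    have e2 : ∫ ω, L (J.restrict fun t ↦ Y t ω) ∂Q = 0 := by
      simp_rw [hL, Finset.restrict]
      rw [integral_finsetSum _ fun i _ ↦ ((m2Y i.1).integrable (by norm_num)).const_mul _]
      simp [integral_const_mul, eY]
    have v : Var[fun ω ↦ L (J.restrict fun t ↦ X t ω); P]
        = Var[fun ω ↦ L (J.restrict fun t ↦ Y t ω); Q] := by
      simp_rw [hL, Finset.restrict]
      rw [← covariance_self (by fun_prop), ← covariance_self (by fun_prop),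
        covariance_fun_sum_fun_sum (fun i : J ↦ (m2X i).const_mul _) (fun i : J ↦ (m2X i).const_mul _),
        covariance_fun_sum_fun_sum (fun i : J ↦ (m2Y i).const_mul _) (fun i : J ↦ (m2Y i).const_mul _)]
      simp [covariance_const_mul_left, covariance_const_mul_right, hcov]
    rw [v, e1, e2]
  have h1 := isProjectiveLimit_map (P := P) (X := X) (measurable_pi_lambda _ mX).aemeasurable
  have h2 := isProjectiveLimit_map (P := Q) (X := Y) (measurable_pi_lambda _ mY).aemeasurable
  rw [show (fun J : Finset T ↦ P.map (fun ω ↦ J.restrict (X · ω)))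
    = fun J ↦ Q.map (fun ω ↦ J.restrict (Y · ω)) from funext key] at h1
  have : ∀ J : Finset T, IsFiniteMeasure (Q.map (fun ω ↦ J.restrict (Y · ω))) := inferInstance
  exact h1.unique h2

/-- The law of generalized grey Brownian motion is that of `√l • B`, with `l` and `B` drawn
independently. -/
theorem IsGGBM.exists_map_eq {Ω Ω' : Type*} [MeasurableSpace Ω] [MeasurableSpace Ω']
    {P : Measure Ω} [IsProbabilityMeasure P] {P' : Measure Ω'} [IsProbabilityMeasure P']
    {α β : ℝ} {X : I → Ω → ℝ} {B : I → Ω' → ℝ} (hX : IsGGBM α β X P)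
    (hB : IsFBM (α / 2) B P') :
    ∃ μ : Measure ℝ, IsProbabilityMeasure μ ∧
      (∀ y, μ.real (Iic y) = ∫ x in Ioc 0 y, MWright β x) ∧
      P.map (fun ω t ↦ X t ω)
        = (P'.prod μ).map (fun z : Ω' × ℝ ↦ fun t ↦ √z.2 * B t z.1) := by
  obtain ⟨Ω₀, _, P₀, L, B₀, hP₀, hB₀, hL, hind, hid⟩ := hX.law
  have mB := measurable_pi_lambda (fun ω t ↦ B t ω) hB.measurable
  have mB₀ := measurable_pi_lambda (fun ω t ↦ B₀ t ω) hB₀.measurable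
  have mX := measurable_pi_lambda (fun ω t ↦ X t ω) hX.measurable
  have pμ : IsProbabilityMeasure (P₀.map L) :=
    Measure.isProbabilityMeasure_map hL.measurable.aemeasurable
  refine ⟨P₀.map L, pμ, fun y ↦ ?_, ?_⟩
  · rw [map_measureReal_apply hL.measurable measurableSet_Iic, hL.prob _ measurableSet_Iic]
    congr 2
    ext x; simp [and_comm]
  have hBB : P₀.map (fun ω t ↦ B₀ t ω) = P'.map (fun ω t ↦ B t ω) :=
    map_eq_of_isGaussianProcess hB₀.measurable hB.measurable hB₀.gaussian hB.gaussian
      hB₀.mean hB.mean fun s t ↦ by rw [hB₀.cov, hB.cov]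
  have mφ : Measurable (fun z : ℝ × (I → ℝ) ↦ fun t ↦ √z.1 * z.2 t) := by fun_prop
  have h1 : P.map (fun ω t ↦ X t ω) = P₀.map (fun ω t ↦ √(L ω) * B₀ t ω) := by
    have mY : ∀ t, Measurable fun ω ↦ √(L ω) * B₀ t ω :=
      fun t ↦ hL.measurable.sqrt.mul (hB₀.measurable t)
    have i1 := isProjectiveLimit_map (P := P) (X := X) mX.aemeasurable
    have i2 := isProjectiveLimit_map (P := P₀) (X := fun t ω ↦ √(L ω) * B₀ t ω)
      (measurable_pi_lambda _ mY).aemeasurable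
    rw [show (fun J : Finset I ↦ P.map (fun ω ↦ J.restrict (X · ω)))
      = fun J ↦ P₀.map (fun ω ↦ J.restrict fun t ↦ √(L ω) * B₀ t ω)
      from funext fun J ↦ (hid J).map_eq] at i1
    have : ∀ J : Finset I,
      IsFiniteMeasure (P₀.map (fun ω ↦ J.restrict fun t ↦ √(L ω) * B₀ t ω)) := inferInstance
    exact i1.unique i2
  have h2 : P₀.map (fun ω ↦ (L ω, fun t ↦ B₀ t ω)) =
      (P₀.map L).prod (P₀.map fun ω t ↦ B₀ t ω) :=
    (indepFun_iff_map_prod_eq_prod_map_map hL.measurable.aemeasurable mB₀.aemeasurable).1 hind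
  have h3 : P₀.map (fun ω t ↦ √(L ω) * B₀ t ω)
      = (P₀.map (fun ω ↦ (L ω, fun t ↦ B₀ t ω))).map
        (fun z : ℝ × (I → ℝ) ↦ fun t ↦ √z.1 * z.2 t) := by
    rw [Measure.map_map mφ (hL.measurable.prodMk mB₀)]
    rfl
  have h4 : (P₀.map L).prod (P'.map fun ω t ↦ B t ω)
      = (P'.prod (P₀.map L)).map (fun z : Ω' × ℝ ↦ (z.2, fun t ↦ B t z.1)) := by
    have h5 := Measure.map_prod_map P' (P₀.map L) mB measurable_id
    rw [Measure.map_id] at h5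
    rw [← Measure.prod_swap, h5, Measure.map_map measurable_swap (mB.prodMap measurable_id)]
    rfl
  rw [h1, h3, h2, hBB, h4, Measure.map_map mφ
    (show Measurable fun z : Ω' × ℝ ↦ (z.2, fun t ↦ B t z.1) from
      measurable_snd.prodMk (mB.comp measurable_fst))]
  rfl

/-- The small ball probabilities of generalized grey Brownian motion as an average over the paths
of fractional Brownian motion. -/
theorem IsGGBM.measureReal_le_eq_integral {Ω Ω' : Type*} [MeasurableSpace Ω] [MeasurableSpace Ω']
    {P : Measure Ω} [IsProbabilityMeasure P] {P' : Measure Ω'} [IsProbabilityMeasure P']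
    {α β : ℝ} {γ : ℝ≥0} {p : Seminorm ℝ (holderSpace γ)} (hpm : Measurable p)
    {X : Ω → holderSpace γ} {B : Ω' → holderSpace γ} (hX : IsGGBM α β (toProcess X) P)
    (hB : IsFBM (α / 2) (toProcess B) P') (h0 : ∀ᵐ ω ∂P', 0 < p (B ω)) {ε : ℝ} (hε : 0 ≤ ε) :
    P.real {ω | p (X ω) ≤ ε}
      = ∫ ω, (∫ x in Ioc 0 ((ε * (p (B ω))⁻¹) ^ 2), MWright β x) ∂P' := by
  obtain ⟨μ, hμ, hF, hmap⟩ := hX.exists_map_eq hB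
  have mX := measurable_pi_lambda (fun ω t ↦ toProcess X t ω) hX.measurable
  have mB := measurable_pi_lambda (fun ω t ↦ toProcess B t ω) hB.measurable
  -- The σ-algebra is induced by evaluations, so the ball is the trace of a measurable set `A` of
  -- functions, on which the identity of laws can be used.
  obtain ⟨A, hA, hpA⟩ : MeasurableSet[MeasurableSpace.comap Subtype.val inferInstance]
    {f : holderSpace γ | p f ≤ ε} := hpm measurableSet_Iic
  have hAX : ∀ f : holderSpace γ, (f : I → ℝ) ∈ A ↔ p f ≤ ε := fun f ↦ Set.ext_iff.1 hpA f
  have e1 : {ω | p (X ω) ≤ ε} = (fun ω t ↦ toProcess X t ω) ⁻¹' A := by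
    ext ω; exact (hAX (X ω)).symm
  have mΦ : Measurable (fun z : Ω' × ℝ ↦ fun t ↦ √z.2 * toProcess B t z.1) := by
    refine measurable_pi_lambda _ fun t ↦ ?_
    exact (measurable_snd.sqrt).mul ((hB.measurable t).comp measurable_fst)
  rw [e1, ← map_measureReal_apply mX hA, hmap, map_measureReal_apply mΦ hA, measureReal_def,
    Measure.prod_apply (mΦ hA), ← integral_toReal]
  · refine integral_congr_ae ?_
    filter_upwards [h0] with ω hω
    change μ.real _ = _
    rw [← hF]
    congr 1
    ext l
    have : (fun t ↦ √l * toProcess B t ω) = ((√l • B ω : holderSpace γ) : I → ℝ) := rfl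
    simp only [mem_preimage, mem_Iic, this, hAX, map_smul_eq_mul, Real.norm_eq_abs,
      abs_of_nonneg (Real.sqrt_nonneg l)]
    -- This also covers `l < 0`, where `√l = 0` and both sides hold.
    rw [← Real.sqrt_le_left (by positivity), ← div_eq_mul_inv, le_div_iff₀ hω]
  · exact (measurable_measure_prodMk_left (mΦ hA)).aemeasurable
  · exact ae_of_all _ fun ω ↦ measure_lt_top _ _

/-! ### The M-Wright series -/

/-- With `E = D^(1/δ)` the term is `(E^m / m!)^δ`, and `(2E)^m / m! ≤ exp(2E)` bounds it by a
geometric sequence of ratio `2^(-δ)`. -/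
theorem summable_pow_div_factorial_rpow {D δ : ℝ} (hD : 0 ≤ D) (hδ : 0 < δ) :
    Summable fun m : ℕ ↦ D ^ m / (m.factorial : ℝ) ^ δ := by
  set E := D ^ δ⁻¹ with hE
  have hE0 : 0 ≤ E := Real.rpow_nonneg hD _
  have hr : (2⁻¹ : ℝ) ^ δ < 1 := Real.rpow_lt_one (by norm_num) (by norm_num) hδ
  have hg := (summable_geometric_of_lt_one (by positivity) hr).mul_left (Real.exp (2 * E) ^ δ)
  refine Summable.of_nonneg_of_le (fun m ↦ by positivity) (fun m ↦ ?_) hg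
  have h1 : E ^ m / m.factorial ≤ Real.exp (2 * E) * 2⁻¹ ^ m := by
    have := Real.pow_div_factorial_le_exp (x := 2 * E) (by positivity) m
    rw [mul_pow] at this
    calc E ^ m / m.factorial = (2 ^ m * E ^ m / m.factorial) * 2⁻¹ ^ m := by
          rw [inv_pow]; field_simp
      _ ≤ _ := by gcongr
  have h2 : D ^ m / (m.factorial : ℝ) ^ δ = (E ^ m / m.factorial) ^ δ := by
    rw [Real.div_rpow (by positivity) (by positivity), hE, ← Real.rpow_natCast (D ^ δ⁻¹),
      ← Real.rpow_mul hD, ← Real.rpow_mul hD, ← Real.rpow_natCast]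
    congr 2
    field_simp
  rw [h2]
  calc (E ^ m / m.factorial) ^ δ ≤ (Real.exp (2 * E) * 2⁻¹ ^ m) ^ δ := by gcongr
    _ = _ := by
      rw [Real.mul_rpow (by positivity) (by positivity), ← Real.rpow_natCast, ← Real.rpow_natCast,
        ← Real.rpow_mul (by norm_num), ← Real.rpow_mul (by norm_num), mul_comm δ]

/-- Growth of the reciprocal Gamma function along the arguments in the `M`-Wright series. -/
theorem abs_inv_Gamma_le {β : ℝ} (hβ₀ : 0 < β) (hβ₁ : β < 1) (n : ℕ) :
    |(Real.Gamma (1 - β - β * n))⁻¹| ≤ ((n + 1).factorial : ℝ) ^ β / (β * (n + 1)) := by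
  set s := β * (n + 1) with hs
  have hs0 : 0 < s := by positivity
  rw [show 1 - β - β * n = 1 - s by rw [hs]; ring]
  have hrefl := Real.Gamma_mul_Gamma_one_sub s
  have hΓ := Real.Gamma_pos_of_pos hs0
  -- Reflection: `1/Γ(1-s) = Γ(s) sin(πs)/π`. At the poles the left side is `0` by convention.
  have h1 : |(Real.Gamma (1 - s))⁻¹| ≤ Real.Gamma s := by
    by_cases h0 : Real.Gamma (1 - s) = 0
    · simp [h0, hΓ.le]
    have hsin : Real.sin (Real.pi * s) ≠ 0 := by
      intro h; rw [h, div_zero] at hrefl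
      exact (mul_ne_zero hΓ.ne' h0) hrefl
    have : (Real.Gamma (1 - s))⁻¹ = Real.Gamma s * (Real.sin (Real.pi * s) / Real.pi) := by
      rw [eq_div_iff hsin] at hrefl
      field_simp
      rw [mul_comm s Real.pi]
      linarith
    rw [this, abs_mul, abs_of_pos hΓ, abs_div, abs_of_pos Real.pi_pos]
    refine mul_le_of_le_one_right hΓ.le ?_
    rw [div_le_one Real.pi_pos]
    linarith [Real.abs_sin_le_one (Real.pi * s), Real.pi_gt_three]
  refine h1.trans ?_
  rw [le_div_iff₀ hs0, mul_comm, ← Real.Gamma_add_one hs0.ne']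
  -- Log-convexity of `Γ` between `n + 2` and `1` with weights `β`, `1 - β`: the intermediate point
  -- is `s + 1`, so `Γ(s+1) ≤ ((n+1)!)^β`.
  have := Real.Gamma_mul_add_mul_le_rpow_Gamma_mul_rpow_Gamma (s := n + 2) (t := 1) (a := β)
    (b := 1 - β) (by positivity) one_pos hβ₀ (by linarith) (by ring)
  rw [Real.Gamma_one, Real.one_rpow, mul_one, show (n : ℝ) + 2 = ((n + 1 : ℕ) : ℝ) + 1 by
    push_cast; ring, Real.Gamma_nat_eq_factorial] at this
  rw [mul_one, show β * (((n + 1 : ℕ) : ℝ) + 1) + (1 - β) = s + 1 by rw [hs]; push_cast; ring]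
    at this
  exact this

/-- Summability of the `M`-Wright coefficients against factorial-type weights of order `q`. -/
theorem summable_mwright_weight {β q : ℝ} (hβ₀ : 0 < β) (hβ₁ : β < 1) (hq : 0 ≤ q)
    (hqβ : q + β < 1) {D : ℝ} (hD : 0 ≤ D) :
    Summable fun n : ℕ ↦ |((n.factorial : ℝ) * Real.Gamma (1 - β - β * n))⁻¹| *
      (D ^ (n + 1) * ((n : ℝ) + 1) ^ (q * (n + 1))) := by
  have hδ : 0 < 1 - β - q := by linarith
  have hs := ((summable_nat_add_iff 1).2 (summable_pow_div_factorial_rpow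
    (D := D * Real.exp q) (by positivity) hδ)).mul_left β⁻¹
  refine Summable.of_nonneg_of_le (fun n ↦ by positivity) (fun n ↦ ?_) hs
  set m := n + 1 with hm
  have hmR : (m : ℝ) = n + 1 := by rw [hm]; push_cast; ring
  have hf : (m.factorial : ℝ) = m * n.factorial := by
    rw [hm, Nat.factorial_succ]; push_cast; ring
  have hm0 : (0 : ℝ) < m := by rw [hmR]; positivity
  have hn0 : (0 : ℝ) < n.factorial := by positivity
  have hf0 : (0 : ℝ) < m.factorial := by positivity
  have h1 : |((n.factorial : ℝ) * Real.Gamma (1 - β - β * n))⁻¹|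
      ≤ β⁻¹ * (m.factorial : ℝ) ^ (β - 1) := by
    rw [mul_inv, abs_mul, abs_of_pos (by positivity : (0 : ℝ) < (n.factorial : ℝ)⁻¹)]
    calc _ ≤ (n.factorial : ℝ)⁻¹ * ((m.factorial : ℝ) ^ β / (β * m)) := by
          have := abs_inv_Gamma_le hβ₀ hβ₁ n
          rw [← hm, ← hmR] at this
          gcongr
      _ = β⁻¹ * ((m.factorial : ℝ) ^ β / m.factorial) := by
          rw [hf]; field_simp
      _ = _ := by rw [Real.rpow_sub_one hf0.ne']
  -- From `m^m ≤ e^m m!`: the weight costs `(m!)^q` and a geometric factor, leaving the negative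
  -- total exponent `β - 1 + q`.
  have h2 : (m : ℝ) ^ (q * m) ≤ Real.exp q ^ m * (m.factorial : ℝ) ^ q := by
    have := Real.pow_div_factorial_le_exp (x := m) hm0.le m
    rw [div_le_iff₀ hf0] at this
    calc (m : ℝ) ^ (q * m) = ((m : ℝ) ^ m) ^ q := by
          rw [mul_comm, Real.rpow_mul hm0.le, Real.rpow_natCast]
      _ ≤ (Real.exp m * m.factorial) ^ q := by gcongr
      _ = _ := by
        rw [Real.mul_rpow (by positivity) (by positivity), ← Real.exp_mul, ← Real.exp_nat_mul]
  rw [← hmR]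
  calc _ ≤ (β⁻¹ * (m.factorial : ℝ) ^ (β - 1)) *
        (D ^ m * (Real.exp q ^ m * (m.factorial : ℝ) ^ q)) := by gcongr
    _ = β⁻¹ * ((D * Real.exp q) ^ m * ((m.factorial : ℝ) ^ (β - 1) * (m.factorial : ℝ) ^ q)) := by
        rw [mul_pow]; ring
    _ = _ := by
        rw [← Real.rpow_add hf0, show β - 1 + q = -(1 - β - q) by ring, Real.rpow_neg hf0.le,
          div_eq_mul_inv]

/-- Termwise integration, justified by `summable_mwright_weight` with `q = 0`, `D = y`. -/
theorem hasSum_integral_mwright {β : ℝ} (hβ₀ : 0 < β) (hβ₁ : β < 1) {y : ℝ} (hy : 0 ≤ y) :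
    HasSum (fun n : ℕ ↦ (-1) ^ n / ((n.factorial : ℝ) * Real.Gamma (1 - β - β * n)) *
      (y ^ (n + 1) / (n + 1))) (∫ x in Ioc 0 y, MWright β x) := by
  have hint : ∀ n : ℕ, ∫ x in Ioc 0 y, x ^ n = y ^ (n + 1) / (n + 1) := by
    intro n
    rw [← intervalIntegral.integral_of_le hy, integral_pow]
    simp
  have hs : Summable fun n : ℕ ↦ |((n.factorial : ℝ) * Real.Gamma (1 - β - β * n))⁻¹| *
      (y ^ (n + 1) / (n + 1)) := by
    refine Summable.of_nonneg_of_le (fun n ↦ by positivity) (fun n ↦ ?_)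
      (summable_mwright_weight hβ₀ hβ₁ le_rfl (by linarith) hy)
    rw [zero_mul, Real.rpow_zero, mul_one]
    gcongr
    exact div_le_self (by positivity) (by linarith [n.cast_nonneg (α := ℝ)])
  have hcont : ∀ n : ℕ, IntegrableOn (fun x : ℝ ↦
      (-x) ^ n / ((n.factorial : ℝ) * Real.Gamma (1 - β - β * n))) (Ioc 0 y) := fun n ↦
    (Continuous.integrableOn_Icc (by fun_prop)).mono_set Ioc_subset_Icc_self
  have hnorm : ∀ n : ℕ, ∫ x in Ioc 0 y,
      ‖(-x) ^ n / ((n.factorial : ℝ) * Real.Gamma (1 - β - β * n))‖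
      = |((n.factorial : ℝ) * Real.Gamma (1 - β - β * n))⁻¹| * (y ^ (n + 1) / (n + 1)) := by
    intro n
    rw [← hint, ← integral_const_mul]
    refine setIntegral_congr_fun measurableSet_Ioc fun x hx ↦ ?_
    simp only [div_eq_mul_inv, norm_mul, norm_pow, norm_neg, Real.norm_eq_abs, abs_of_pos hx.1]
    ring
  have := hasSum_integral_of_summable_integral_norm (μ := volume.restrict (Ioc 0 y)) hcont
    (by simpa only [hnorm] using hs)
  have heq : (fun n : ℕ ↦ (-1) ^ n / ((n.factorial : ℝ) * Real.Gamma (1 - β - β * n)) *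
      (y ^ (n + 1) / (n + 1))) = fun n : ℕ ↦ ∫ x in Ioc 0 y,
        (-x) ^ n / ((n.factorial : ℝ) * Real.Gamma (1 - β - β * n)) := funext fun n ↦ ?_
  · rw [heq]; exact this
  rw [← hint, ← integral_const_mul]
  refine integral_congr_ae (ae_of_all _ fun x ↦ ?_)
  simp only
  rw [neg_pow x n]
  ring

/-- Second order expansion at `0` of the distribution function of the `M`-Wright density. -/
theorem exists_abs_integral_mwright_sub_le {β : ℝ} (hβ₀ : 0 < β) (hβ₁ : β < 1) :
    ∃ K : ℝ, 0 ≤ K ∧ ∀ y ∈ Icc (0 : ℝ) 1,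
      |(∫ x in Ioc 0 y, MWright β x) - y / Real.Gamma (1 - β)| ≤ K * y ^ 2 := by
  have hs := summable_mwright_weight hβ₀ hβ₁ le_rfl (by linarith : 0 + β < 1) zero_le_one
  simp only [zero_mul, Real.rpow_zero, mul_one, one_pow] at hs
  have hs1 := (summable_nat_add_iff 1).2 hs
  refine ⟨∑' n : ℕ, |(((n + 1).factorial : ℝ) * Real.Gamma (1 - β - β * (n + 1 : ℕ)))⁻¹|,
    tsum_nonneg fun n ↦ abs_nonneg _, fun y hy ↦ ?_⟩
  have h := (hasSum_nat_add_iff' 1).2 (hasSum_integral_mwright hβ₀ hβ₁ hy.1)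
  simp only [Finset.range_one, Finset.sum_singleton, pow_zero, Nat.factorial_zero, Nat.cast_one,
    Nat.cast_zero, mul_zero, sub_zero, one_mul, zero_add, pow_one, div_one] at h
  rw [show y / Real.Gamma (1 - β) = 1 / Real.Gamma (1 - β) * y by ring]
  refine h.norm_le_of_bounded (hs1.hasSum.mul_right (y ^ 2)) fun n ↦ ?_
  rw [norm_mul, div_eq_mul_inv, norm_mul, norm_pow, norm_neg, norm_one, one_pow, one_mul,
    Real.norm_eq_abs]
  gcongr
  rw [Real.norm_of_nonneg (by have := hy.1; positivity)]
  calc y ^ (n + 1 + 1) / (((n + 1 : ℕ) : ℝ) + 1) ≤ y ^ (n + 2) :=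
        div_le_self (by have := hy.1; positivity) (by linarith [(n + 1).cast_nonneg (α := ℝ)])
    _ ≤ y ^ 2 := pow_le_pow_of_le_one hy.1 hy.2 (by omega)

/-! ### Negative moments from the small ball bound -/

/-- The bound tends to `0` with `ε`. Positivity reconciles the conventions at norm zero: the inverse
is `∞` in `ℝ≥0∞` but `0` in `ℝ`. -/
theorem ae_pos_of_tail {Ω : Type*} [MeasurableSpace Ω] {P : Measure Ω}
    [IsProbabilityMeasure P] {N : Ω → ℝ} {K c θ : ℝ} (hc : 0 < c) (hθ : 0 < θ)
    (htail : ∀ ε ∈ Ioc (0 : ℝ) 1, P.real {ω | N ω ≤ ε} ≤ K * Real.exp (-c * ε ^ (-θ))) :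
    ∀ᵐ ω ∂P, 0 < N ω := by
  have h : P.real {ω | N ω ≤ 0} ≤ 0 := by
    have hlim : Tendsto (fun ε : ℝ ↦ K * Real.exp (-c * ε ^ (-θ))) (𝓝[>] 0) (𝓝 (K * 0)) := by
      refine Tendsto.const_mul _ (Real.tendsto_exp_atBot.comp ?_)
      simp_rw [neg_mul]
      exact tendsto_neg_atTop_atBot.comp
        ((tendsto_rpow_neg_nhdsGT_zero (by linarith)).const_mul_atTop hc)
    rw [mul_zero] at hlim
    refine ge_of_tendsto hlim ?_
    filter_upwards [Ioc_mem_nhdsGT one_pos] with ε hε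
    exact (measureReal_mono fun ω hω ↦ le_trans hω hε.1.le).trans (htail ε hε)
  have h0 : P {ω | N ω ≤ 0} = 0 := by
    rw [← measureReal_eq_zero_iff]; exact le_antisymm h measureReal_nonneg
  rw [ae_iff]
  simpa using h0

/-- Exponential integrability of `N ^ (-θ)` under an exponential small ball estimate. -/
theorem lintegral_exp_rpow_neg_lt_top {Ω : Type*} [MeasurableSpace Ω] {P : Measure Ω}
    [IsProbabilityMeasure P] {N : Ω → ℝ} (mN : Measurable N) (hN : ∀ ω, 0 ≤ N ω)
    {K c θ : ℝ} (hc : 0 < c) (hθ : 0 < θ)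
    (htail : ∀ ε ∈ Ioc (0 : ℝ) 1, P.real {ω | N ω ≤ ε} ≤ K * Real.exp (-c * ε ^ (-θ))) :
    ∫⁻ ω, ENNReal.ofReal (Real.exp (c / 2 * N ω ^ (-θ))) ∂P < ∞ := by
  set c' := c / 2 with hc'
  have hc'0 : 0 < c' := by positivity
  -- At least `1`, so that the tail bound on `S n` also holds for `n = 0`, where no `ε` is
  -- available.
  set K' := max K 1 with hK'
  have hK'0 : 0 < K' := lt_of_lt_of_le one_pos (le_max_right _ _)
  -- Layers of `u = N^(-θ)`: where `⌊u⌋ = n` the integrand is at most `exp(c'(n+1))`, while `S n`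
  -- has mass at most `K' exp(-2c'n)`; halving `c` leaves a geometric series.
  let S : ℕ → Set Ω := fun n ↦ {ω | (n : ℝ) ≤ N ω ^ (-θ)}
  have mS : ∀ n, MeasurableSet (S n) := fun n ↦
    measurableSet_le measurable_const (mN.pow_const _)
  have hS : ∀ n : ℕ, P.real (S n) ≤ K' * Real.exp (-(2 * c' * n)) := by
    intro n
    rcases Nat.eq_zero_or_pos n with rfl | hn
    · have h1 : P.real (S 0) ≤ K' := measureReal_le_one.trans (le_max_right K 1)
      simpa using h1
    have hn1 : (1 : ℝ) ≤ n := by exact_mod_cast hn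
    have hn0 : (0 : ℝ) < n := by linarith
    set ε : ℝ := (n : ℝ) ^ (-θ⁻¹) with hε
    have hεn : ε ^ (-θ) = n := by
      rw [hε, ← Real.rpow_mul hn0.le, neg_mul_neg, inv_mul_cancel₀ hθ.ne', Real.rpow_one]
    have hε0 : 0 < ε := by positivity
    have hε1 : ε ≤ 1 := Real.rpow_le_one_of_one_le_of_nonpos hn1 (by simp [hθ.le])
    calc P.real (S n) ≤ P.real {ω | N ω ≤ ε} := by
          refine measureReal_mono fun ω (hω : (n : ℝ) ≤ N ω ^ (-θ)) ↦ ?_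
          have hpos : 0 < N ω := by
            rcases (hN ω).eq_or_lt with h | h
            · rw [← h, Real.zero_rpow (by linarith)] at hω; linarith
            · exact h
          rw [← hεn] at hω
          exact (Real.rpow_le_rpow_iff_of_neg hε0 hpos (by linarith)).1 hω
      _ ≤ K * Real.exp (-c * ε ^ (-θ)) := htail ε ⟨hε0, hε1⟩
      _ ≤ K' * Real.exp (-c * ε ^ (-θ)) := by gcongr; exact le_max_left _ _
      _ = _ := by rw [hεn, hc']; congr 2; ring
  have hpt : ∀ ω, ENNReal.ofReal (Real.exp (c' * N ω ^ (-θ))) ≤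
      ∑' n : ℕ, (S n).indicator (fun _ ↦ ENNReal.ofReal (Real.exp (c' * (n + 1)))) ω := by
    intro ω
    set u := N ω ^ (-θ) with hu
    have hu0 : 0 ≤ u := Real.rpow_nonneg (hN ω) _
    refine le_trans ?_ (ENNReal.le_tsum ⌊u⌋₊)
    rw [indicator_of_mem (show ω ∈ S ⌊u⌋₊ from Nat.floor_le hu0)]
    gcongr
    exact (Nat.lt_floor_add_one u).le
  have hsum : Summable fun n : ℕ ↦ K' * Real.exp c' * Real.exp (-c') ^ n :=
    (summable_geometric_of_lt_one (Real.exp_pos _).le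
      (Real.exp_lt_one_iff.2 (by linarith))).mul_left _
  calc _ ≤ ∫⁻ ω, ∑' n : ℕ,
        (S n).indicator (fun _ ↦ ENNReal.ofReal (Real.exp (c' * (n + 1)))) ω ∂P :=
        lintegral_mono hpt
    _ = ∑' n : ℕ, ENNReal.ofReal (Real.exp (c' * (n + 1))) * P (S n) := by
        rw [lintegral_tsum fun n ↦ (measurable_const.indicator (mS n)).aemeasurable]
        simp_rw [lintegral_indicator_const (mS _)]
    _ ≤ ∑' n : ℕ, ENNReal.ofReal (K' * Real.exp c' * Real.exp (-c') ^ n) := by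
        refine ENNReal.tsum_le_tsum fun n ↦ ?_
        rw [← ofReal_measureReal (measure_ne_top _ _), ← ENNReal.ofReal_mul (Real.exp_pos _).le]
        refine ENNReal.ofReal_le_ofReal ?_
        calc _ ≤ Real.exp (c' * (n + 1)) * (K' * Real.exp (-(2 * c' * n))) := by
              gcongr; exact hS n
          _ = _ := by
              rw [← Real.exp_nat_mul, mul_left_comm, mul_assoc K', ← Real.exp_add, ← Real.exp_add]
              congr 2; ring
    _ < ∞ := by
        rw [← ENNReal.ofReal_tsum_of_nonneg (fun n ↦ by positivity) hsum]
        exact ENNReal.ofReal_lt_top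

/-- Growth of the even negative moments under an exponential small ball estimate. -/
theorem exists_lintegral_inv_pow_le {Ω : Type*} [MeasurableSpace Ω] {P : Measure Ω}
    [IsProbabilityMeasure P] {N : Ω → ℝ} (mN : Measurable N) (hN : ∀ ω, 0 ≤ N ω)
    {K c θ : ℝ} (hc : 0 < c) (hθ : 0 < θ)
    (htail : ∀ ε ∈ Ioc (0 : ℝ) 1, P.real {ω | N ω ≤ ε} ≤ K * Real.exp (-c * ε ^ (-θ))) :
    ∃ A D : ℝ, 0 ≤ A ∧ 0 ≤ D ∧ ∀ n : ℕ,
      ∫⁻ ω, (ENNReal.ofReal (N ω))⁻¹ ^ (2 * n + 2) ∂P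
        ≤ ENNReal.ofReal (A * (D ^ (n + 1) * ((n : ℝ) + 1) ^ (2 / θ * (n + 1)))) := by
  have hE := lintegral_exp_rpow_neg_lt_top mN hN hc hθ htail
  set c' := c / 2 with hc'
  have hc'0 : 0 < c' := by positivity
  set E := ∫⁻ ω, ENNReal.ofReal (Real.exp (c' * N ω ^ (-θ))) ∂P with hEdef
  have hpos := ae_pos_of_tail hc hθ htail
  refine ⟨E.toReal, (2 / (θ * c')) ^ (2 / θ), ENNReal.toReal_nonneg, by positivity, fun n ↦ ?_⟩
  set m : ℝ := 2 / θ * (n + 1) with hm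
  have hm0 : 0 < m := by positivity
  have hbound : ∀ᵐ ω ∂P, (ENNReal.ofReal (N ω))⁻¹ ^ (2 * n + 2)
      ≤ ENNReal.ofReal ((m / c') ^ m) * ENNReal.ofReal (Real.exp (c' * N ω ^ (-θ))) := by
    filter_upwards [hpos] with ω hω
    rw [← ENNReal.ofReal_inv_of_pos hω, ← ENNReal.ofReal_pow (by positivity),
      ← ENNReal.ofReal_mul (by positivity)]
    refine ENNReal.ofReal_le_ofReal ?_
    set u := N ω ^ (-θ) with hu
    have hu0 : 0 < u := Real.rpow_pos_of_pos hω _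
    have h1 : (N ω)⁻¹ ^ (2 * n + 2) = u ^ m := by
      rw [hu, ← Real.rpow_mul hω.le, inv_pow, ← Real.rpow_natCast, ← Real.rpow_neg hω.le]
      congr 1
      rw [hm]; push_cast; field_simp
    -- This is `x ≤ e^x` at `x = c'u/m`; its `m`-th power gives `u^m ≤ (m/c')^m exp(c'u)`, the
    -- source of the witness `D`.
    have h2 : u ≤ m / c' * Real.exp (c' * u / m) := by
      have := Real.add_one_le_exp (c' * u / m)
      calc u = m / c' * (c' * u / m) := by field_simp
        _ ≤ _ := by gcongr; linarith
    rw [h1]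
    calc u ^ m ≤ (m / c' * Real.exp (c' * u / m)) ^ m := by gcongr
      _ = _ := by
        rw [Real.mul_rpow (by positivity) (by positivity), ← Real.exp_mul]
        congr 2; field_simp
  calc _ ≤ ∫⁻ ω, ENNReal.ofReal ((m / c') ^ m) * ENNReal.ofReal (Real.exp (c' * N ω ^ (-θ))) ∂P :=
        lintegral_mono_ae hbound
    _ = ENNReal.ofReal ((m / c') ^ m) * E := lintegral_const_mul' _ _ ENNReal.ofReal_ne_top
    _ = ENNReal.ofReal (E.toReal * (m / c') ^ m) := by
        rw [mul_comm E.toReal, ENNReal.ofReal_mul (by positivity), ENNReal.ofReal_toReal hE.ne]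
    _ = _ := by
        congr 2
        have : m / c' = (2 / (θ * c')) * (n + 1) := by rw [hm]; field_simp
        rw [this, Real.mul_rpow (by positivity) (by positivity), ← Real.rpow_natCast,
          ← Real.rpow_mul (by positivity)]
        congr 2
        rw [hm]; push_cast; ring

theorem measurable_of_isFBM {Ω : Type*} [MeasurableSpace Ω] {P : Measure Ω} {H : ℝ} {γ : ℝ≥0}
    {B : Ω → holderSpace γ} (hB : IsFBM H (toProcess B) P) : Measurable B :=
  (measurable_pi_lambda (fun ω t ↦ toProcess B t ω) hB.measurable).subtype_mk
    (h := fun ω ↦ (B ω).2)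

theorem negMoment_eq_lintegral_ofReal {Ω : Type*} [MeasurableSpace Ω] {P : Measure Ω} {γ : ℝ≥0}
    {p : Seminorm ℝ (holderSpace γ)} {B : Ω → holderSpace γ} (h0 : ∀ᵐ ω ∂P, 0 < p (B ω)) (k : ℕ) :
    negMoment p B P k = ∫⁻ ω, ENNReal.ofReal ((p (B ω))⁻¹ ^ k) ∂P := by
  refine lintegral_congr_ae ?_
  filter_upwards [h0] with ω hω
  rw [ENNReal.ofReal_pow (by positivity), ENNReal.ofReal_inv_of_pos hω]

theorem toReal_negMoment {Ω : Type*} [MeasurableSpace Ω] {P : Measure Ω} {γ : ℝ≥0}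
    {p : Seminorm ℝ (holderSpace γ)} {B : Ω → holderSpace γ} (mN : Measurable fun ω ↦ p (B ω))
    (h0 : ∀ᵐ ω ∂P, 0 < p (B ω)) (k : ℕ) :
    (negMoment p B P k).toReal = ∫ ω, (p (B ω))⁻¹ ^ k ∂P := by
  rw [negMoment_eq_lintegral_ofReal h0, integral_eq_lintegral_of_nonneg_ae
    (ae_of_all _ fun ω ↦ pow_nonneg (inv_nonneg.2 (apply_nonneg p _)) _)
    (mN.inv.pow_const k).aestronglyMeasurable]

theorem integrable_inv_pow_of_negMoment_lt_top {Ω : Type*} [MeasurableSpace Ω] {P : Measure Ω}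
    {γ : ℝ≥0} {p : Seminorm ℝ (holderSpace γ)} {B : Ω → holderSpace γ}
    (mN : Measurable fun ω ↦ p (B ω)) (h0 : ∀ᵐ ω ∂P, 0 < p (B ω)) {k : ℕ}
    (hk : negMoment p B P k < ∞) : Integrable (fun ω ↦ (p (B ω))⁻¹ ^ k) P := by
  refine ⟨(mN.inv.pow_const k).aestronglyMeasurable, ?_⟩
  rw [hasFiniteIntegral_iff_ofReal
    (ae_of_all _ fun ω ↦ pow_nonneg (inv_nonneg.2 (apply_nonneg p _)) _),
    ← negMoment_eq_lintegral_ofReal h0]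
  exact hk

/-! ### Averaging over paths: series and asymptotics -/

section

variable {Ω Ω' : Type*} [MeasurableSpace Ω] [MeasurableSpace Ω']
    {P : Measure Ω} [IsProbabilityMeasure P] {P' : Measure Ω'} [IsProbabilityMeasure P']
    {α β : ℝ} {γ : ℝ≥0} {p : Seminorm ℝ (holderSpace γ)}
    {X : Ω → holderSpace γ} {B : Ω' → holderSpace γ}

/-- The expansion of `F((ε/‖B‖)²)` is integrated termwise; the expected absolute terms are summable
by `summable_mwright_weight` with `q = 2/θ`. -/
theorem smallBallSeries_of_tail (hβ₀ : 0 < β) (hβ₁ : β < 1) (hpm : Measurable p)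
    (hX : IsGGBM α β (toProcess X) P) (hB : IsFBM (α / 2) (toProcess B) P')
    {K c θ : ℝ} (hc : 0 < c) (hθ : 0 < θ)
    (htail : ∀ ε ∈ Ioc (0 : ℝ) 1,
      P'.real {ω | p (B ω) ≤ ε} ≤ K * Real.exp (-c * ε ^ (-θ)))
    (hθβ : 2 / θ + β < 1) : SmallBallSeries β p X P B P' := by
  have mN : Measurable fun ω ↦ p (B ω) := hpm.comp (measurable_of_isFBM hB)
  have h0 := ae_pos_of_tail hc hθ htail
  obtain ⟨A, D, hA, hD, hmom⟩ :=
    exists_lintegral_inv_pow_le mN (fun ω ↦ apply_nonneg p _) hc hθ htail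
  have hfin : ∀ n : ℕ, negMoment p B P' (2 * n + 2) < ∞ :=
    fun n ↦ (hmom n).trans_lt ENNReal.ofReal_lt_top
  refine ⟨hfin, fun ε hε ↦ ?_⟩
  rw [hX.measureReal_le_eq_integral hpm hB h0 hε]
  set a : ℕ → ℝ := fun n ↦ (-1) ^ n / ((n.factorial : ℝ) * Real.Gamma (1 - β - β * n)) with ha
  have ha_abs : ∀ n, |a n| = |((n.factorial : ℝ) * Real.Gamma (1 - β - β * n))⁻¹| := fun n ↦ by
    simp [ha, abs_div]
  set G : ℕ → Ω' → ℝ := fun n ω ↦ (a n * ε ^ (2 * n + 2) / (n + 1)) * (p (B ω))⁻¹ ^ (2 * n + 2)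
    with hG
  have hGsum : ∀ ω, HasSum (G · ω) (∫ x in Ioc 0 ((ε * (p (B ω))⁻¹) ^ 2), MWright β x) := by
    intro ω
    have h := hasSum_integral_mwright hβ₀ hβ₁ (sq_nonneg (ε * (p (B ω))⁻¹))
    have e : (G · ω) = fun n : ℕ ↦
        (-1) ^ n / ((n.factorial : ℝ) * Real.Gamma (1 - β - β * n)) *
          (((ε * (p (B ω))⁻¹) ^ 2) ^ (n + 1) / (n + 1)) := by
      funext n
      simp only [hG, ha]
      rw [← pow_mul, mul_pow, show 2 * (n + 1) = 2 * n + 2 by ring]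
      ring
    rw [e]; exact h
  have hGint : ∀ n, Integrable (G n) P' := fun n ↦
    (integrable_inv_pow_of_negMoment_lt_top mN h0 (hfin n)).const_mul _
  have hGnorm : ∀ n, ∫ ω, ‖G n ω‖ ∂P'
      = |a n| * ε ^ (2 * n + 2) / (n + 1) * (negMoment p B P' (2 * n + 2)).toReal := by
    intro n
    rw [toReal_negMoment mN h0, ← integral_const_mul]
    refine integral_congr_ae (ae_of_all _ fun ω ↦ ?_)
    have hn : (0 : ℝ) < n + 1 := by positivity
    have hi : 0 ≤ (p (B ω))⁻¹ := inv_nonneg.2 (apply_nonneg p _)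
    simp only [hG]
    rw [norm_mul, norm_div, norm_mul, Real.norm_eq_abs, Real.norm_of_nonneg (by positivity),
      Real.norm_of_nonneg hn.le, Real.norm_of_nonneg (by positivity)]
  have hsummable : Summable fun n ↦ ∫ ω, ‖G n ω‖ ∂P' := by
    have hs := (summable_mwright_weight hβ₀ hβ₁ (by positivity : 0 ≤ 2 / θ) hθβ
      (by positivity : 0 ≤ ε ^ 2 * D)).mul_left A
    refine Summable.of_nonneg_of_le (fun n ↦ integral_nonneg fun ω ↦ norm_nonneg _)
      (fun n ↦ ?_) hs
    rw [hGnorm, ← ha_abs]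
    have hm : (negMoment p B P' (2 * n + 2)).toReal
        ≤ A * (D ^ (n + 1) * ((n : ℝ) + 1) ^ (2 / θ * (n + 1))) :=
      ENNReal.toReal_le_of_le_ofReal (by positivity) (hmom n)
    calc |a n| * ε ^ (2 * n + 2) / (n + 1) * (negMoment p B P' (2 * n + 2)).toReal
        ≤ |a n| * ε ^ (2 * n + 2) * (A * (D ^ (n + 1) * ((n : ℝ) + 1) ^ (2 / θ * (n + 1)))) := by
          gcongr
          exact div_le_self (by positivity) (by linarith [n.cast_nonneg (α := ℝ)])
      _ = _ := by
          rw [mul_pow, ← pow_mul, show 2 * (n + 1) = 2 * n + 2 by ring]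
          ring
  have key := hasSum_integral_of_summable_integral_norm hGint hsummable
  simp_rw [fun ω ↦ (hGsum ω).tsum_eq] at key
  have e : (fun n : ℕ ↦ 2 * ((-1) ^ n * (negMoment p B P' (2 * n + 2)).toReal /
      ((2 * n + 2) * (n.factorial : ℝ) * Real.Gamma (1 - β - β * n)) * ε ^ (2 * n + 2)))
      = fun n ↦ ∫ ω, G n ω ∂P' := by
    funext n
    simp only [hG]
    rw [integral_const_mul, ← toReal_negMoment mN h0, ha]
    have h2 : (2 * (n : ℝ) + 2) = 2 * (n + 1) := by ring
    have hn : (n : ℝ) + 1 ≠ 0 := by positivity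
    simp only [h2, div_eq_mul_inv, mul_inv]
    ring
  rw [e]; exact key

/-- Dominated convergence for `ε⁻² F((ε/‖B‖)²)`: the expansion of `F` at `0` gives the limit, and a
global linear bound on `F` gives the majorant, a multiple of `‖B‖⁻²`. -/
theorem isEquivalent_of_tail (hβ₀ : 0 < β) (hβ₁ : β < 1) (hpm : Measurable p)
    (hX : IsGGBM α β (toProcess X) P) (hB : IsFBM (α / 2) (toProcess B) P')
    {K c θ : ℝ} (hc : 0 < c) (hθ : 0 < θ)
    (htail : ∀ ε ∈ Ioc (0 : ℝ) 1,
      P'.real {ω | p (B ω) ≤ ε} ≤ K * Real.exp (-c * ε ^ (-θ))) :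
    negMoment p B P' 2 < ∞ ∧
      Asymptotics.IsEquivalent (𝓝[>] 0) (fun ε : ℝ ↦ P.real {ω | p (X ω) ≤ ε})
        (fun ε : ℝ ↦ (negMoment p B P' 2).toReal * ε ^ 2 / Real.Gamma (1 - β)) := by
  have mN : Measurable fun ω ↦ p (B ω) := hpm.comp (measurable_of_isFBM hB)
  have h0 := ae_pos_of_tail hc hθ htail
  obtain ⟨A, D, hA, hD, hmom⟩ :=
    exists_lintegral_inv_pow_le mN (fun ω ↦ apply_nonneg p _) hc hθ htail
  have hfin : negMoment p B P' 2 < ∞ := (hmom 0).trans_lt ENNReal.ofReal_lt_top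
  refine ⟨hfin, ?_⟩
  have hint := integrable_inv_pow_of_negMoment_lt_top mN h0 hfin
  have hη : (negMoment p B P' 2).toReal = ∫ ω, (p (B ω))⁻¹ ^ 2 ∂P' := toReal_negMoment mN h0 2
  set η := (negMoment p B P' 2).toReal
  have hη0 : 0 < η := by
    rw [hη, integral_pos_iff_support_of_nonneg (fun ω ↦ sq_nonneg _) hint]
    have : P' (Function.support fun ω ↦ (p (B ω))⁻¹ ^ 2) = 1 := by
      rw [← prob_compl_eq_zero_iff₀]
      · refine measure_mono_null ?_ (ae_iff.1 h0)
        intro ω hω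
        simpa using (by simpa using hω : p (B ω) = 0).le
      · exact ((mN.inv.pow_const 2) (measurableSet_singleton 0).compl).nullMeasurableSet
    rw [this]
    exact one_pos
  have hΓ : 0 < Real.Gamma (1 - β) := Real.Gamma_pos_of_pos (by linarith)
  obtain ⟨μ, hμ, hF, -⟩ := hX.exists_map_eq hB
  obtain ⟨K₂, hK₂, hexp⟩ := exists_abs_integral_mwright_sub_le hβ₀ hβ₁
  set F : ℝ → ℝ := fun y ↦ ∫ x in Ioc 0 y, MWright β x with hFdef
  have mF : Measurable F := by
    refine Monotone.measurable fun x y hxy ↦ ?_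
    simp only [hFdef, ← hF]
    exact measureReal_mono (Iic_subset_Iic.2 hxy)
  -- The expansion serves for `y ≤ 1`; beyond, `F ≤ 1 < y`, which accounts for the `+ 1`.
  have hFle : ∀ y, 0 ≤ y → |F y| ≤ ((Real.Gamma (1 - β))⁻¹ + K₂ + 1) * y := by
    intro y hy
    rcases le_or_gt y 1 with h1 | h1
    · have h2 := hexp y ⟨hy, h1⟩
      have h3 : |F y| ≤ y / Real.Gamma (1 - β) + K₂ * y ^ 2 := by
        have h4 := abs_sub_abs_le_abs_sub (F y) (y / Real.Gamma (1 - β))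
        rw [abs_of_nonneg (by positivity : 0 ≤ y / Real.Gamma (1 - β))] at h4
        linarith
      have h5 : K₂ * y ^ 2 ≤ K₂ * y := by gcongr; nlinarith
      rw [div_eq_inv_mul] at h3
      nlinarith
    · have h2 : |F y| ≤ 1 := by
        simp only [hFdef, ← hF]
        rw [abs_of_nonneg measureReal_nonneg]
        exact measureReal_le_one
      have : 0 ≤ ((Real.Gamma (1 - β))⁻¹ + K₂) * y := by positivity
      linarith
  have hlim : Tendsto (fun ε : ℝ ↦ ∫ ω, F ((ε * (p (B ω))⁻¹) ^ 2) / ε ^ 2 ∂P') (𝓝[>] 0)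
      (𝓝 (∫ ω, (Real.Gamma (1 - β))⁻¹ * (p (B ω))⁻¹ ^ 2 ∂P')) := by
    refine tendsto_integral_filter_of_dominated_convergence
      (fun ω ↦ ((Real.Gamma (1 - β))⁻¹ + K₂ + 1) * (p (B ω))⁻¹ ^ 2) ?_ ?_ (hint.const_mul _) ?_
    · refine Eventually.of_forall fun ε ↦ ?_
      exact ((mF.comp ((mN.inv.const_mul ε).pow_const 2)).div_const _).aestronglyMeasurable
    · filter_upwards [self_mem_nhdsWithin] with ε hε
      have hε0 : (0 : ℝ) < ε ^ 2 := pow_pos hε 2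
      refine ae_of_all _ fun ω ↦ ?_
      rw [norm_div, Real.norm_of_nonneg hε0.le, div_le_iff₀ hε0, Real.norm_eq_abs]
      refine (hFle _ (sq_nonneg _)).trans_eq ?_
      ring
    · refine ae_of_all _ fun ω ↦ ?_
      set b := (p (B ω))⁻¹
      rw [← tendsto_sub_nhds_zero_iff]
      have hz : Tendsto (fun ε : ℝ ↦ K₂ * b ^ 4 * ε ^ 2) (𝓝[>] 0) (𝓝 0) := by
        have : Tendsto (fun ε : ℝ ↦ K₂ * b ^ 4 * ε ^ 2) (𝓝 0) (𝓝 (K₂ * b ^ 4 * 0 ^ 2)) :=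
          Continuous.tendsto (by fun_prop) _
        simpa using this.mono_left nhdsWithin_le_nhds
      refine squeeze_zero_norm' ?_ hz
      have hsmall : ∀ᶠ ε : ℝ in 𝓝[>] 0, (ε * b) ^ 2 < 1 := by
        have : Tendsto (fun ε : ℝ ↦ (ε * b) ^ 2) (𝓝 0) (𝓝 ((0 * b) ^ 2)) :=
          Continuous.tendsto (by fun_prop) _
        refine (this.mono_left nhdsWithin_le_nhds).eventually_lt_const ?_
        simp
      filter_upwards [self_mem_nhdsWithin, hsmall] with ε hε hs
      have hε0 : (0 : ℝ) < ε ^ 2 := pow_pos hε 2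
      have h2 := hexp ((ε * b) ^ 2) ⟨sq_nonneg _, hs.le⟩
      have e1 : F ((ε * b) ^ 2) / ε ^ 2 - (Real.Gamma (1 - β))⁻¹ * b ^ 2
          = (F ((ε * b) ^ 2) - (ε * b) ^ 2 / Real.Gamma (1 - β)) / ε ^ 2 := by
        have e2 : (Real.Gamma (1 - β))⁻¹ * b ^ 2 = (ε * b) ^ 2 / Real.Gamma (1 - β) / ε ^ 2 := by
          have : ε ≠ 0 := (show 0 < ε from hε).ne'
          field_simp
        rw [e2, sub_div]
      rw [e1, norm_div, Real.norm_of_nonneg hε0.le, div_le_iff₀ hε0, Real.norm_eq_abs]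
      refine h2.trans_eq ?_
      ring
  rw [integral_const_mul, ← hη] at hlim
  rw [Asymptotics.isEquivalent_iff_tendsto_one]
  · have h3 := hlim.mul_const (Real.Gamma (1 - β) / η)
    rw [show (Real.Gamma (1 - β))⁻¹ * η * (Real.Gamma (1 - β) / η) = 1 by field_simp] at h3
    refine h3.congr' ?_
    filter_upwards [self_mem_nhdsWithin] with ε hε
    have hε0 : (0 : ℝ) < ε := hε
    rw [Pi.div_apply, hX.measureReal_le_eq_integral hpm hB h0 hε0.le, integral_div]
    simp only [hFdef]
    field_simp
  · filter_upwards [self_mem_nhdsWithin] with ε hε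
    have hε0 : (0 : ℝ) < ε := hε
    positivity

end

/-! ### Linear prediction under nonpositive correlations -/

/-- A strictly diagonally dominant system with nonpositive off-diagonal entries. -/
theorem Matrix.exists_mulVec_eq_neg_le_one {ι : Type*} [Fintype ι] [DecidableEq ι]
    (G : Matrix ι ι ℝ) (g : ι → ℝ) (hg : ∀ i, g i ≤ 0) (hoff : ∀ i j, i ≠ j → G i j ≤ 0)
    (hrow : ∀ i, 0 < ∑ j, G i j + g i) : ∃ x : ι → ℝ, G.mulVec x = -g ∧ ∀ i, x i ≤ 1 := by
  have hsplit : ∀ i (y : ι → ℝ), ∑ j, G i j * y j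
      = G i i * y i + ∑ j ∈ Finset.univ.erase i, G i j * y j := fun i y ↦
    (Finset.add_sum_erase _ _ (Finset.mem_univ i)).symm
  have hdet : G.det ≠ 0 := by
    refine det_ne_zero_of_sum_row_lt_diag fun i ↦ ?_
    have h1 := hrow i
    have h2 := hsplit i 1
    simp only [Pi.one_apply, mul_one] at h2
    have h3 : ∑ j ∈ Finset.univ.erase i, ‖G i j‖ = -∑ j ∈ Finset.univ.erase i, G i j := by
      rw [← Finset.sum_neg_distrib]
      refine Finset.sum_congr rfl fun j hj ↦ ?_
      rw [Real.norm_of_nonpos (hoff i j (Finset.ne_of_mem_erase hj).symm)]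
    rw [h3]
    have := Real.le_norm_self (G i i)
    linarith [hg i]
  have hu : IsUnit G.det := isUnit_iff_ne_zero.2 hdet
  refine ⟨G⁻¹.mulVec (-g), by rw [Matrix.mulVec_mulVec, Matrix.mul_nonsing_inv _ hu,
    Matrix.one_mulVec], ?_⟩
  set x := G⁻¹.mulVec (-g) with hx
  have hGx : ∀ i, ∑ j, G i j * x j = -g i := fun i ↦ by
    have : G.mulVec x = -g := by
      rw [hx, Matrix.mulVec_mulVec, Matrix.mul_nonsing_inv _ hu, Matrix.one_mulVec]
    exact congrFun this i
  intro i
  have : Nonempty ι := ⟨i⟩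
  -- Maximum principle: if `R` is the row sum at a maximal entry, then `x i₀ * R ≤ -g i₀ < R` with
  -- `R > 0`, so `x i₀ < 1`.
  obtain ⟨i₀, hi₀⟩ := Finite.exists_max x
  refine (hi₀ i).trans ?_
  by_contra! hlt
  have h1 : ∑ j, G i₀ j * x i₀ ≤ ∑ j, G i₀ j * x j := by
    refine Finset.sum_le_sum fun j _ ↦ ?_
    rcases eq_or_ne i₀ j with rfl | hne
    · exact le_rfl
    · exact mul_le_mul_of_nonpos_left (hi₀ j) (hoff _ _ hne)
  rw [← Finset.sum_mul, hGx] at h1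
  nlinarith [hrow i₀, hg i₀]

/-- Coefficients of the best linear predictor of the `k`-th variable from the previous ones, for a
covariance `c` with nonpositive correlations. -/
theorem exists_residual_coeff (c : ℕ → ℕ → ℝ) {k : ℕ} {w : ℝ}
    (hoff : ∀ i ≤ k, ∀ j ≤ k, i ≠ j → c i j ≤ 0)
    (hrow : ∀ i < k, 0 < ∑ j ∈ Finset.range (k + 1), c i j)
    (hw : w ≤ ∑ j ∈ Finset.range (k + 1), c k j) :
    ∃ x : ℕ → ℝ, x k = 1 ∧ (∀ i < k, ∑ j ∈ Finset.range (k + 1), x j * c i j = 0) ∧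
      w ≤ ∑ j ∈ Finset.range (k + 1), x j * c k j := by
  -- The normal equations for the residual: `y` is minus the vector of predictor coefficients.
  obtain ⟨y, hy, hy1⟩ := Matrix.exists_mulVec_eq_neg_le_one
    (Matrix.of fun i j : Fin k ↦ c i j) (fun i ↦ c i k)
    (fun i ↦ hoff i i.2.le k le_rfl i.2.ne)
    (fun i j hij ↦ hoff i i.2.le j j.2.le (fun h ↦ hij (Fin.ext h)))
    (fun i ↦ by
      have := hrow i i.2
      rw [Finset.sum_range_succ, Finset.sum_range] at this
      exact this)
  let x : ℕ → ℝ := fun j ↦ if h : j < k then y ⟨j, h⟩ else 1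
  have hxk : x k = 1 := by simp [x]
  have hxj : ∀ j : Fin k, x j = y j := fun j ↦ by simp [x]
  have hx1 : ∀ j, x j ≤ 1 := fun j ↦ by
    by_cases h : j < k
    · simpa [x, h] using hy1 ⟨j, h⟩
    · simp [x, h]
  refine ⟨x, hxk, fun i hi ↦ ?_, hw.trans ?_⟩
  · rw [Finset.sum_range_succ, Finset.sum_range, hxk, one_mul]
    have h := congrFun hy ⟨i, hi⟩
    simp only [Matrix.mulVec, dotProduct, Matrix.of_apply, Pi.neg_apply] at h
    simp_rw [hxj, mul_comm (y _)]
    linarith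
  -- For `j < k`, `x j ≤ 1` and `c k j ≤ 0` give `c k j ≤ x j * c k j`.
  · refine Finset.sum_le_sum fun j hj ↦ ?_
    rcases (Nat.lt_succ_iff.1 (Finset.mem_range.1 hj)).eq_or_lt with rfl | hlt
    · rw [hxk, one_mul]
    · nlinarith [hx1 j, hoff k le_rfl j hlt.le hlt.ne']

/-! ### Small balls of Gaussian partial sums -/

/-- The density is at most `1/√(2πw)` on an interval of length `2ε`. Uniformity in the shift `a` is
what conditioning requires. -/
theorem gaussianReal_abs_add_le {m : ℝ} {v : ℝ≥0} {w : ℝ} (hw : 0 < w) (hv : w ≤ v) (a : ℝ)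
    {ε : ℝ} :
    gaussianReal m v {y | |y + a| ≤ ε} ≤ ENNReal.ofReal (2 * ε / √(2 * Real.pi * w)) := by
  have hv0 : v ≠ 0 := by
    intro h; rw [h] at hv; simp at hv; linarith
  have hset : {y : ℝ | |y + a| ≤ ε} = Icc (-ε - a) (ε - a) := by
    ext y; simp only [mem_ofPred_eq, abs_le, mem_Icc]
    constructor <;> rintro ⟨h1, h2⟩ <;> constructor <;> linarith
  rw [gaussianReal_apply m hv0, hset]
  calc ∫⁻ x in Icc (-ε - a) (ε - a), gaussianPDF m v x
      ≤ ∫⁻ _ in Icc (-ε - a) (ε - a), ENNReal.ofReal (√(2 * Real.pi * w))⁻¹ := by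
        refine lintegral_mono fun x ↦ ENNReal.ofReal_le_ofReal ?_
        rw [gaussianPDFReal_def]
        calc (√(2 * Real.pi * v))⁻¹ * Real.exp (-(x - m) ^ 2 / (2 * v))
            ≤ (√(2 * Real.pi * w))⁻¹ * 1 := by
              gcongr
              rw [Real.exp_le_one_iff, neg_div]
              exact neg_nonpos.2 (by positivity)
          _ = _ := mul_one _
    _ = _ := by
        rw [setLIntegral_const, Real.volume_Icc, ← ENNReal.ofReal_mul (by positivity)]
        congr 1
        ring

/-- Fubini: with `V` frozen, `φ (V ω)` is a constant shift. -/
theorem ProbabilityTheory.IndepFun.measure_inter_le {Ω E : Type*} [MeasurableSpace Ω] [MeasurableSpace E]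
    {P : Measure Ω} [IsProbabilityMeasure P] {η : Ω → ℝ} {V : Ω → E} (hη : Measurable η)
    (hV : Measurable V) (h : IndepFun η V P) {S : Set E} (hS : MeasurableSet S) {φ : E → ℝ}
    (hφ : Measurable φ) {ε : ℝ} {C : ℝ≥0∞} (hC : ∀ a, P.map η {y | |y + a| ≤ ε} ≤ C) :
    P {ω | V ω ∈ S ∧ |η ω + φ (V ω)| ≤ ε} ≤ C * P (V ⁻¹' S) := by
  have hprod := (indepFun_iff_map_prod_eq_prod_map_map hη.aemeasurable hV.aemeasurable).1 h
  have : IsProbabilityMeasure (P.map η) := Measure.isProbabilityMeasure_map hη.aemeasurable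
  have : IsProbabilityMeasure (P.map V) := Measure.isProbabilityMeasure_map hV.aemeasurable
  let T : Set (ℝ × E) := {z | z.2 ∈ S ∧ |z.1 + φ z.2| ≤ ε}
  have hT : MeasurableSet T := (measurable_snd hS).inter
    (measurableSet_le (measurable_fst.add (hφ.comp measurable_snd)).abs measurable_const)
  have e : {ω | V ω ∈ S ∧ |η ω + φ (V ω)| ≤ ε} = (fun ω ↦ (η ω, V ω)) ⁻¹' T := rfl
  rw [e, ← Measure.map_apply (hη.prodMk hV) hT, hprod, Measure.prod_apply_symm hT,
    ← Measure.map_apply hV hS, ← setLIntegral_const, ← lintegral_indicator hS]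
  refine lintegral_mono fun z ↦ ?_
  by_cases hz : z ∈ S
  · rw [indicator_of_mem hz]
    exact (measure_mono fun y hy ↦ hy.2).trans (hC (φ z))
  · have : (fun x ↦ (x, z)) ⁻¹' T = ∅ := by
      ext y; simp [T, hz]
    rw [this, measure_empty]
    exact zero_le

/-- Small ball estimate for the partial sums of Gaussian variables with nonpositive correlations. -/
theorem ProbabilityTheory.IsGaussianProcess.measure_partialSum_le {Ω : Type*} [MeasurableSpace Ω]
    {P : Measure Ω} [IsProbabilityMeasure P] {ξ : ℕ → Ω → ℝ} (hξ : IsGaussianProcess ξ P)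
    (mξ : ∀ i, Measurable (ξ i)) {n : ℕ} {w : ℝ} (hw : 0 < w)
    (hoff : ∀ i < n, ∀ j < n, i ≠ j → cov[ξ i, ξ j; P] ≤ 0)
    (hrow : ∀ k < n, ∀ i < k, 0 < ∑ j ∈ Finset.range (k + 1), cov[ξ i, ξ j; P])
    (hlast : ∀ k < n, w ≤ ∑ j ∈ Finset.range (k + 1), cov[ξ k, ξ j; P])
    {ε : ℝ} {k : ℕ} (hk : k ≤ n) :
    P {ω | ∀ j < k, |∑ i ∈ Finset.range (j + 1), ξ i ω| ≤ ε}
      ≤ ENNReal.ofReal (2 * ε / √(2 * Real.pi * w)) ^ k := by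
  induction k with
  | zero => simp
  | succ k ih =>
    have hkn : k < n := hk
    obtain ⟨x, hxk, hx0, hxw⟩ := exists_residual_coeff (fun i j ↦ cov[ξ i, ξ j; P])
      (fun i hi j hj ↦ hoff i (hi.trans_lt hkn) j (hj.trans_lt hkn)) (hrow k hkn) (hlast k hkn)
    have m2 : ∀ i, MemLp (ξ i) 2 P := fun i ↦ (hξ.hasGaussianLaw_eval i).memLp_two
    -- The residual of `ξ k`: uncorrelated with the past `V`, hence independent of it by joint
    -- Gaussianity. The next partial sum is `η + φ(V)`.
    let η : Ω → ℝ := fun ω ↦ ∑ j ∈ Finset.range (k + 1), x j * ξ j ω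
    have mη : Measurable η := Finset.measurable_fun_sum _ fun j _ ↦ (mξ j).const_mul _
    have m2η : MemLp η 2 P := memLp_finsetSum _ fun j _ ↦ (m2 j).const_mul _
    have hcovη : ∀ i, cov[ξ i, η; P] = ∑ j ∈ Finset.range (k + 1), x j * cov[ξ i, ξ j; P] := by
      intro i
      rw [covariance_fun_sum_right' (fun j _ ↦ (m2 j).const_mul _) (m2 i)]
      simp [covariance_const_mul_right]
    let V : Ω → Fin k → ℝ := fun ω i ↦ ξ i ω
    have mV : Measurable V := measurable_pi_lambda _ fun i ↦ mξ i
    have hgauss : IsGaussianProcess (Sum.elim (fun _ : Unit ↦ η) fun i : Fin k ↦ ξ i) P := by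
      refine hξ.of_isGaussianProcess fun s ↦ ?_
      rcases s with _ | i
      · refine ⟨Finset.range (k + 1), ∑ j : Finset.range (k + 1),
          x j • ContinuousLinearMap.proj (R := ℝ) (φ := fun _ : Finset.range (k + 1) ↦ ℝ) j,
          fun ω ↦ ?_⟩
        simp only [Sum.elim_inl, η, sum_apply, smul_apply,
          ContinuousLinearMap.proj_apply, Finset.restrict, smul_eq_mul]
        exact (Finset.sum_coe_sort (Finset.range (k + 1)) fun j ↦ x j * ξ j ω).symm
      · exact ⟨{(i : ℕ)}, ContinuousLinearMap.proj (R := ℝ)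
          (φ := fun _ : ({(i : ℕ)} : Finset ℕ) ↦ ℝ) ⟨i, by simp⟩, fun ω ↦ rfl⟩
    have hind : IndepFun η V P := by
      have h := hgauss.indepFun_of_covariance_eq_zero (fun _ ↦ mη.aemeasurable)
        (fun i ↦ (mξ i).aemeasurable) (fun _ i ↦ by
          rw [covariance_comm, hcovη]; exact hx0 i i.2)
      exact h.comp (measurable_pi_apply ()) measurable_id
    -- By orthogonality to the past, `Var η = cov(ξ k, η)`, which `exists_residual_coeff` bounds
    -- below.
    have hvar : w ≤ Var[η; P] := by
      rw [← covariance_self mη.aemeasurable]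
      have : cov[η, η; P] = ∑ j ∈ Finset.range (k + 1), x j * cov[ξ j, η; P] := by
        rw [covariance_fun_sum_left' (fun j _ ↦ (m2 j).const_mul _) m2η]
        simp [covariance_const_mul_left]
      rw [this, Finset.sum_range_succ, Finset.sum_eq_zero, zero_add, hxk, one_mul, hcovη]
      · exact hxw
      · intro j hj
        rw [hcovη, hx0 j (Finset.mem_range.1 hj), mul_zero]
    have hlaw : P.map η = gaussianReal P[η] Var[η; P].toNNReal :=
      (hgauss.hasGaussianLaw_eval (Sum.inl ())).map_eq_gaussianReal
    let S : Set (Fin k → ℝ) := {u | ∀ j : Fin k, |∑ i : Fin k, if i ≤ j then u i else 0| ≤ ε}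
    let φ : (Fin k → ℝ) → ℝ := fun u ↦ ∑ i : Fin k, (1 - x i) * u i
    have hS : MeasurableSet S := by
      simp only [S, ofPred_forall]
      refine MeasurableSet.iInter fun j ↦ measurableSet_le ?_ measurable_const
      refine (Finset.measurable_fun_sum _ fun i _ ↦ ?_).abs
      split_ifs <;> fun_prop
    have hφ : Measurable φ := by fun_prop
    have hSV : V ⁻¹' S = {ω | ∀ j < k, |∑ i ∈ Finset.range (j + 1), ξ i ω| ≤ ε} := by
      ext ω
      have : ∀ j < k, ∑ i : Fin k, (if (i : ℕ) ≤ j then ξ i ω else 0)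
          = ∑ i ∈ Finset.range (j + 1), ξ i ω := by
        intro j hj
        rw [← Finset.sum_range (fun i ↦ if i ≤ j then ξ i ω else 0), ← Finset.sum_filter]
        congr 1
        ext i; simp; omega
      simp only [mem_preimage, S, V, mem_ofPred_eq, Fin.le_def]
      constructor
      · intro h j hj
        rw [← this j hj]; exact h ⟨j, hj⟩
      · intro h j
        rw [this j j.2]; exact h j j.2
    have hηφ : ∀ ω, η ω + φ (V ω) = ∑ i ∈ Finset.range (k + 1), ξ i ω := by
      intro ω
      simp only [η, φ, V]
      rw [← Finset.sum_range (fun i ↦ (1 - x i) * ξ i ω), Finset.sum_range_succ,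
        Finset.sum_range_succ, hxk, one_mul, add_right_comm, ← Finset.sum_add_distrib]
      congr 1
      exact Finset.sum_congr rfl fun i _ ↦ by ring
    have hset : {ω | ∀ j < k + 1, |∑ i ∈ Finset.range (j + 1), ξ i ω| ≤ ε}
        = {ω | V ω ∈ S ∧ |η ω + φ (V ω)| ≤ ε} := by
      ext ω
      have h1 : V ω ∈ S ↔ ∀ j < k, |∑ i ∈ Finset.range (j + 1), ξ i ω| ≤ ε :=
        Set.ext_iff.1 hSV ω
      simp only [mem_ofPred_eq, h1, hηφ, Nat.lt_succ_iff_lt_or_eq]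
      constructor
      · exact fun h ↦ ⟨fun j hj ↦ h j (Or.inl hj), h k (Or.inr rfl)⟩
      · rintro ⟨h, h'⟩ j (hj | rfl)
        exacts [h j hj, h']
    rw [hset, pow_succ']
    refine (IndepFun.measure_inter_le mη mV hind hS hφ
      (C := ENNReal.ofReal (2 * ε / √(2 * Real.pi * w))) fun a ↦ ?_).trans ?_
    · rw [hlaw]
      exact gaussianReal_abs_add_le hw (hvar.trans (Real.le_coe_toNNReal _)) a
    · rw [hSV]
      gcongr
      exact ih hkn.le

/-! ### Fractional Brownian motion in the uniform norm -/

/-- The point `i / n` of the unit interval, for `i ≤ n`. -/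
noncomputable def unitGrid (n i : ℕ) : I := projIcc 0 1 zero_le_one ((i : ℝ) / n)

theorem coe_unitGrid {n i : ℕ} (hi : i ≤ n) : (unitGrid n i : ℝ) = (i : ℝ) / n := by
  have h : ((i : ℝ) / n) ∈ Icc (0 : ℝ) 1 :=
    ⟨by positivity, div_le_one_of_le₀ (by exact_mod_cast hi) (by positivity)⟩
  rw [unitGrid, projIcc_of_mem _ h]

theorem unitGrid_zero (n : ℕ) : unitGrid n 0 = 0 := by
  ext; rw [coe_unitGrid (Nat.zero_le n)]; simp

theorem IsFBM.covariance_increment {Ω : Type*} [MeasurableSpace Ω] {P : Measure Ω}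
    [IsProbabilityMeasure P] {H : ℝ} {B : I → Ω → ℝ} (hB : IsFBM H B P) (s t u v : I) :
    cov[fun ω ↦ B t ω - B s ω, fun ω ↦ B v ω - B u ω; P] =
      (|(t : ℝ) - u| ^ (2 * H) + |(s : ℝ) - v| ^ (2 * H)
        - |(t : ℝ) - v| ^ (2 * H) - |(s : ℝ) - u| ^ (2 * H)) / 2 := by
  have m2 : ∀ t, MemLp (B t) 2 P := fun t ↦ (hB.gaussian.hasGaussianLaw_eval t).memLp_two
  have m2' : MemLp (fun ω ↦ B v ω - B u ω) 2 P := (m2 v).sub (m2 u)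
  rw [covariance_fun_sub_left (m2 t) (m2 s) m2',
    covariance_fun_sub_right (m2 t) (m2 v) (m2 u), covariance_fun_sub_right (m2 s) (m2 v) (m2 u)]
  simp only [hB.cov]
  ring

/-- Midpoint concavity of `x^r`; with `r = 2H` it makes distinct grid increments nonpositively
correlated. -/
theorem rpow_add_add_rpow_sub_le {r d h : ℝ} (hr0 : 0 ≤ r) (hr1 : r ≤ 1) (hh : 0 ≤ h)
    (hd : h ≤ d) : (d + h) ^ r + (d - h) ^ r ≤ 2 * d ^ r := by
  obtain ⟨-, hconc⟩ := Real.concaveOn_rpow hr0 hr1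
  have := hconc (mem_Ici.2 (by linarith : 0 ≤ d + h)) (mem_Ici.2 (by linarith : 0 ≤ d - h))
    (by norm_num : (0 : ℝ) ≤ 1 / 2) (by norm_num : (0 : ℝ) ≤ 1 / 2) (by norm_num)
  simp only [smul_eq_mul] at this
  rw [show 1 / 2 * (d + h) + 1 / 2 * (d - h) = d by ring] at this
  linarith

/-- For `H ≤ 1/2`, small ball estimate for fractional Brownian motion on a regular grid. -/
theorem IsFBM.measure_grid_le {Ω : Type*} [MeasurableSpace Ω] {P : Measure Ω}
    [IsProbabilityMeasure P] {H : ℝ} (hH₀ : 0 < H) (hH : 2 * H ≤ 1) {B : I → Ω → ℝ}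
    (hB : IsFBM H B P) (hB0 : ∀ ω, B 0 ω = 0) {n : ℕ} (hn : 0 < n) (ε : ℝ) :
    P {ω | ∀ t, |B t ω| ≤ ε} ≤ ENNReal.ofReal (2 * ε * (n : ℝ) ^ H / √Real.pi) ^ n := by
  have hn0 : (0 : ℝ) < n := by exact_mod_cast hn
  let ξ : ℕ → Ω → ℝ := fun i ω ↦ B (unitGrid n (i + 1)) ω - B (unitGrid n i) ω
  have mξ : ∀ i, Measurable (ξ i) := fun i ↦ (hB.measurable _).sub (hB.measurable _)
  have hξ : IsGaussianProcess ξ P := by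
    classical
    refine hB.gaussian.of_isGaussianProcess fun i ↦
      ⟨{unitGrid n (i + 1), unitGrid n i},
        ContinuousLinearMap.proj (R := ℝ)
          (φ := fun _ : ({unitGrid n (i + 1), unitGrid n i} : Finset I) ↦ ℝ)
          ⟨unitGrid n (i + 1), by simp⟩ - ContinuousLinearMap.proj (R := ℝ)
          (φ := fun _ : ({unitGrid n (i + 1), unitGrid n i} : Finset I) ↦ ℝ)
          ⟨unitGrid n i, by simp⟩, fun ω ↦ rfl⟩
  set r := 2 * H with hr
  have hr0 : 0 < r := by positivity
  have hcov : ∀ i < n, ∀ j < n, cov[ξ i, ξ j; P] =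
      (|(i : ℝ) / n + 1 / n - j / n| ^ r + |(i : ℝ) / n - j / n - 1 / n| ^ r
        - 2 * |(i : ℝ) / n - j / n| ^ r) / 2 := by
    intro i hi j hj
    rw [hB.covariance_increment, coe_unitGrid hi.le, coe_unitGrid hj.le,
      coe_unitGrid (Nat.succ_le_of_lt hi), coe_unitGrid (Nat.succ_le_of_lt hj)]
    have e1 : ((i + 1 : ℕ) : ℝ) / n - j / n = i / n + 1 / n - j / n := by push_cast; ring
    have e2 : (i : ℝ) / n - (j + 1 : ℕ) / n = i / n - j / n - 1 / n := by push_cast; ring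
    have e3 : ((i + 1 : ℕ) : ℝ) / n - (j + 1 : ℕ) / n = i / n - j / n := by push_cast; ring
    rw [e1, e2, e3]
    ring
  have hoff_lt : ∀ i < n, ∀ j < n, j < i → cov[ξ i, ξ j; P] ≤ 0 := by
    intro i hi j hj hji
    rw [hcov i hi j hj]
    have hd : 1 / (n : ℝ) ≤ (i : ℝ) / n - j / n := by
      rw [← sub_div]
      gcongr
      have : (j : ℝ) + 1 ≤ i := by exact_mod_cast hji
      linarith
    have hh : (0 : ℝ) ≤ 1 / n := by positivity
    have := rpow_add_add_rpow_sub_le hr0.le hH hh hd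
    rw [abs_of_nonneg (by linarith), abs_of_nonneg (by linarith), abs_of_nonneg (by linarith),
      show (i : ℝ) / n + 1 / n - j / n = i / n - j / n + 1 / n by ring]
    linarith
  have hoff : ∀ i < n, ∀ j < n, i ≠ j → cov[ξ i, ξ j; P] ≤ 0 := by
    intro i hi j hj hij
    rcases hij.lt_or_gt with h | h
    · rw [covariance_comm]; exact hoff_lt j hj i hi h
    · exact hoff_lt i hi j hj h
  have m2 : ∀ t, MemLp (B t) 2 P := fun t ↦ (hB.gaussian.hasGaussianLaw_eval t).memLp_two
  -- The increments telescope, so each row sum is a covariance with `B((k+1)/n) - B(0)`.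
  have hsum : ∀ k < n, ∀ i ≤ k, ∑ j ∈ Finset.range (k + 1), cov[ξ i, ξ j; P] =
      (((i : ℝ) / n + 1 / n) ^ r - ((i : ℝ) / n) ^ r + (((k : ℝ) - i) / n + 1 / n) ^ r
        - (((k : ℝ) - i) / n) ^ r) / 2 := by
    intro k hk i hi
    have m2ξ : ∀ j, MemLp (ξ j) 2 P := fun j ↦ (m2 _).sub (m2 _)
    rw [← covariance_fun_sum_right' (fun j _ ↦ m2ξ j) (m2ξ i)]
    have : (fun ω ↦ ∑ j ∈ Finset.range (k + 1), ξ j ω)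
        = fun ω ↦ B (unitGrid n (k + 1)) ω - B (unitGrid n 0) ω := by
      funext ω
      exact Finset.sum_range_sub (fun j ↦ B (unitGrid n j) ω) (k + 1)
    rw [this, hB.covariance_increment, coe_unitGrid (hi.trans hk.le), coe_unitGrid (Nat.zero_le n),
      coe_unitGrid (Nat.succ_le_of_lt hk), coe_unitGrid (Nat.succ_le_of_lt (hi.trans_lt hk))]
    have hik : (0 : ℝ) ≤ (k : ℝ) - i := by
      have : (i : ℝ) ≤ k := by exact_mod_cast hi
      linarith
    have e1 : ((i + 1 : ℕ) : ℝ) / n - (0 : ℕ) / n = i / n + 1 / n := by push_cast; ring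
    have e2 : (i : ℝ) / n - (k + 1 : ℕ) / n = -(((k : ℝ) - i) / n + 1 / n) := by
      push_cast; ring
    have e3 : ((i + 1 : ℕ) : ℝ) / n - (k + 1 : ℕ) / n = -(((k : ℝ) - i) / n) := by
      push_cast; ring
    have e4 : (i : ℝ) / n - (0 : ℕ) / n = i / n := by push_cast; ring
    rw [e1, e2, e3, e4, abs_neg, abs_neg, abs_of_nonneg (by positivity),
      abs_of_nonneg (by positivity), abs_of_nonneg (by positivity), abs_of_nonneg (by positivity)]
    ring
  have hmono : ∀ a : ℝ, 0 ≤ a → a ^ r < (a + 1 / n) ^ r := fun a ha ↦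
    Real.rpow_lt_rpow ha (by simpa using hn0) hr0
  have hrow : ∀ k < n, ∀ i < k, 0 < ∑ j ∈ Finset.range (k + 1), cov[ξ i, ξ j; P] := by
    intro k hk i hi
    rw [hsum k hk i hi.le]
    have hik : (0 : ℝ) ≤ (k : ℝ) - i := by
      have : (i : ℝ) ≤ k := by exact_mod_cast hi.le
      linarith
    linarith [hmono (i / n) (by positivity), hmono (((k : ℝ) - i) / n) (by positivity)]
  -- For `i = k` the last two terms of `hsum` give exactly this; the remaining difference is
  -- positive.
  set w : ℝ := (1 / n) ^ r / 2 with hw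
  have hlast : ∀ k < n, w ≤ ∑ j ∈ Finset.range (k + 1), cov[ξ k, ξ j; P] := by
    intro k hk
    rw [hsum k hk k le_rfl, sub_self, zero_div, zero_add, Real.zero_rpow hr0.ne', hw]
    linarith [hmono (k / n) (by positivity)]
  have hw0 : 0 < w := by positivity
  have key := hξ.measure_partialSum_le mξ hw0 hoff hrow hlast (ε := ε) le_rfl
  have hsq : √(2 * Real.pi * w) = √Real.pi / (n : ℝ) ^ H := by
    have : 2 * Real.pi * w = Real.pi * ((n : ℝ) ^ H)⁻¹ ^ 2 := by
      rw [hw, one_div, Real.inv_rpow hn0.le, hr, mul_comm 2 H, Real.rpow_mul hn0.le, inv_pow]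
      norm_cast
      ring
    rw [this, Real.sqrt_mul Real.pi_pos.le, Real.sqrt_sq (by positivity), div_eq_mul_inv]
  rw [hsq, div_div_eq_mul_div] at key
  refine le_trans (measure_mono ?_) key
  intro ω hω j _
  have : ∑ i ∈ Finset.range (j + 1), ξ i ω = B (unitGrid n (j + 1)) ω := by
    have h := Finset.sum_range_sub (fun j ↦ B (unitGrid n j) ω) (j + 1)
    rw [unitGrid_zero, hB0, sub_zero] at h
    exact h
  rw [this]
  exact hω _

/-- The grid size is `n = ⌊(1/(4ε))^(1/H)⌋`. Then `n^H ≤ 1/(4ε)` and `√π ≥ 3/2` make each factor at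
most `1/3 ≤ e⁻¹`. Rounding costs the prefactor `e`; `n = 0` is trivial. -/
theorem IsFBM.measureReal_forall_abs_le {Ω : Type*} [MeasurableSpace Ω] {P : Measure Ω}
    [IsProbabilityMeasure P] {H : ℝ} (hH₀ : 0 < H) (hH : 2 * H ≤ 1) {B : I → Ω → ℝ}
    (hB : IsFBM H B P) (hB0 : ∀ ω, B 0 ω = 0) {ε : ℝ} (hε : 0 < ε) :
    P.real {ω | ∀ t, |B t ω| ≤ ε}
      ≤ Real.exp 1 * Real.exp (-((1 / 4) ^ H⁻¹) * ε ^ (-H⁻¹)) := by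
  set z : ℝ := (1 / 4 / ε) ^ H⁻¹ with hz
  have hz0 : 0 ≤ z := by positivity
  have hzε : (1 / 4) ^ H⁻¹ * ε ^ (-H⁻¹) = z := by
    rw [hz, Real.div_rpow (by norm_num) hε.le, Real.rpow_neg hε.le,
      ← div_eq_mul_inv]
  rw [neg_mul, hzε, ← Real.exp_add]
  have hexp : Real.exp (-(⌊z⌋₊ : ℝ)) ≤ Real.exp (1 + -z) :=
    Real.exp_le_exp.2 (by linarith [Nat.lt_floor_add_one z])
  refine le_trans ?_ hexp
  rcases Nat.eq_zero_or_pos ⌊z⌋₊ with h0 | hn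
  · rw [h0]; simp
  set n := ⌊z⌋₊
  have hn0 : (0 : ℝ) < n := by exact_mod_cast hn
  have h1 : (n : ℝ) ^ H ≤ 1 / 4 / ε := by
    calc (n : ℝ) ^ H ≤ z ^ H := by gcongr; exact Nat.floor_le hz0
      _ = _ := by rw [hz, ← Real.rpow_mul (by positivity), inv_mul_cancel₀ hH₀.ne', Real.rpow_one]
  have hpi : 3 / 2 ≤ √Real.pi := Real.le_sqrt_of_sq_le (by linarith [Real.pi_gt_three])
  have h2 : 2 * ε * (n : ℝ) ^ H / √Real.pi ≤ Real.exp (-1) := by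
    calc 2 * ε * (n : ℝ) ^ H / √Real.pi ≤ 2 * ε * (1 / 4 / ε) / (3 / 2) := by gcongr
      _ = 1 / 3 := by field_simp; norm_num
      _ ≤ Real.exp (-1) := by
        rw [Real.exp_neg, one_div]
        exact inv_anti₀ (Real.exp_pos 1) (by linarith [Real.exp_one_lt_d9])
  have h3 := hB.measure_grid_le hH₀ hH hB0 hn ε
  rw [← ENNReal.ofReal_pow (by positivity)] at h3
  refine (ENNReal.toReal_le_of_le_ofReal (by positivity) h3).trans ?_
  calc _ ≤ Real.exp (-1) ^ n := by gcongr
    _ = _ := by rw [← Real.exp_nat_mul]; congr 1; ring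

/-- The Hölder bound against `f 0 = 0` makes `|f|` bounded; an unbounded real supremum would default
to `0`. -/
theorem abs_apply_le_of_eq_iSup {γ : ℝ≥0} {p : Seminorm ℝ (holderSpace γ)}
    (hsup : ∀ f : holderSpace γ, p f = ⨆ t : I, |(f : I → ℝ) t|) (f : holderSpace γ) (t : I) :
    |(f : I → ℝ) t| ≤ p f := by
  rw [hsup]
  obtain ⟨C, hC⟩ := f.2.2
  refine le_ciSup (f := fun t : I ↦ |(f : I → ℝ) t|) ⟨C, ?_⟩ t
  rintro _ ⟨s, rfl⟩
  have h := hC.dist_le s 0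
  have hs : dist s 0 ≤ 1 := by
    rw [Subtype.dist_eq, Real.dist_eq]
    simpa [abs_of_nonneg s.2.1] using s.2.2
  rw [f.2.1, Real.dist_eq, sub_zero] at h
  refine h.trans (mul_le_of_le_one_right C.2 ?_)
  exact Real.rpow_le_one dist_nonneg hs γ.2

theorem theorem1 {Ω Ω' : Type*} [MeasurableSpace Ω] [MeasurableSpace Ω']
    (P : Measure Ω) [IsProbabilityMeasure P] (P' : Measure Ω') [IsProbabilityMeasure P']
    (α β H : ℝ) (hα₀ : 0 < α) (hα₂ : α < 2) (hβ₀ : 0 < β) (hβ₁ : β < 1) (hH : H = α / 2)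
    (γ : ℝ≥0) (hγ₀ : 0 < γ) (hγH : (γ : ℝ) < H)
    -- a (measurable) norm on the Hölder space
    (p : Seminorm ℝ (holderSpace γ)) (hp : ∀ f, p f = 0 → f = 0) (hpm : Measurable p)
    -- generalized grey Brownian motion `X = B_{α,β}` and fractional Brownian motion `B = B_H`
    (X : Ω → holderSpace γ) (hX : IsGGBM α β (toProcess X) P)
    (B : Ω' → holderSpace γ) (hB : IsFBM H (toProcess B) P') :
    (∀ θ : ℝ, SmallBallEstimate p B P' θ →
      (negMoment p B P' 2 < ∞ ∧
        Asymptotics.IsEquivalent (𝓝[>] 0) (fun ε : ℝ => P.real {ω | p (X ω) ≤ ε})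
          (fun ε : ℝ => (negMoment p B P' 2).toReal * ε ^ 2 / Real.Gamma (1 - β))) ∧
      (2 / θ + β < 1 → SmallBallSeries β p X P B P')) ∧
    ((∀ f : holderSpace γ, p f = ⨆ t : I, |(f : I → ℝ) t|) → α + β < 1 →
      SmallBallSeries β p X P B P') := by
  subst hH
  refine ⟨fun θ ⟨hθ, C₁, _, C₂, hC₂, hest⟩ ↦ ?_, fun hsup hαβ ↦ ?_⟩
  · have htail : ∀ ε ∈ Ioc (0 : ℝ) 1,
        P'.real {ω | p (B ω) ≤ ε} ≤ 1 * Real.exp (-C₂ * ε ^ (-θ)) := fun ε hε ↦ by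
      rw [one_mul]
      -- `x ≤ exp (log x)` holds at `x = 0` too, so null balls need no separate case.
      exact (Real.le_exp_log _).trans (Real.exp_le_exp.2 (hest ε hε).2)
    exact ⟨isEquivalent_of_tail hβ₀ hβ₁ hpm hX hB hC₂ hθ htail,
      smallBallSeries_of_tail hβ₀ hβ₁ hpm hX hB hC₂ hθ htail⟩
  · have hH₀ : 0 < α / 2 := by positivity
    -- Here `2/θ = α`, so `α + β < 1` is the series condition; it also yields `2H = α ≤ 1`, needed
    -- for the grid estimate.
    refine smallBallSeries_of_tail (K := Real.exp 1) (c := (1 / 4) ^ (α / 2)⁻¹) (θ := (α / 2)⁻¹)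
      hβ₀ hβ₁ hpm hX hB (by positivity) (by positivity) (fun ε hε ↦ ?_) ?_
    · refine le_trans (measureReal_mono ?_)
        (hB.measureReal_forall_abs_le hH₀ (by linarith) (fun ω ↦ (B ω).2.1) hε.1)
      intro ω hω t
      exact (abs_apply_le_of_eq_iSup hsup (B ω) t).trans hω
    · rw [div_inv_eq_mul]
      linarith
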